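/- Let $\Gamma$ be a countably infinite discrete group with identity $\mathbf 1$, and let $S\subset\Gamma$ be a finite set. We identify $k$ with $\{0,\dots,k-1\}$. **Spaces and patterns.** A $\Gamma$-space is a topological space with a continuous action of $\Gamma$; it is free if all stabilizers are trivial. The space $2^\Gamma$ carries the product topology and the action $(\gamma\cdot x)(\delta)=x(\delta\gamma)$, and $\mathrm{Free}(2^\Gamma)$ is the subspace of points with trivial stabilizer. A space is zero-dimensional if it has a base of clopen sets. For $k\ge 1$, a $k$-pattern is a map $p\colon \mathrm{dom}(p)\to k$ with $\mathrm{dom}(p)\subset\Gamma$ finite. It occurs in a coloring $f\colon X\to k$ of a $\Gamma$-space $X$ if there is $x\in X$ with $f(\gamma\cdot x)=p(\gamma)$ for all $\gamma\in\mathrm{dom}(p)$. **Labeled graphs.** An $S$-labeled graph is a simple undirected graph with a labeling $\lambda$ that assigns to each ordered pair $(x,y)$ of adjacent vertices an element $\lambda(x,y)\in S\cup S^{-1}$ such that $\lambda(y,x)=\lambda(x,y)^{-1}$. A homomorphism of $S$-labeled graphs is a map of the vertex sets that preserves adjacency and the labels of adjacent pairs. The Cayley graph $G(\Gamma,S)$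 has vertex set $\Gamma$, with distinct $x,y$ adjacent if and only if $yx^{-1}\in S\cup S^{-1}$, and $\lambda(x,y)=yx^{-1}$; $G(F,S)$ is its subgraph induced by $F\subseteq\Gamma$. A $k$-pattern $p$ is $S$-connected if $G(\mathrm{dom}(p),S)$ is connected (and nonempty). It occurs in a coloring $f\colon V(G)\to k$ of an $S$-labeled graph $G$ if there is a homomorphism $\phi\colon G(\mathrm{dom}(p),S)\to G$ with $f\circ\phi=p$. A coloring (of a $\Gamma$-space or of an $S$-labeled graph) is $\mathscr P$-avoiding if no $p\in\mathscr P$ occurs in it. **The graphs $H_{D,n}$.** For a finite set $D\subset\Gamma$ with $S\cup S^{-1}\cup\{\mathbf 1\}\subseteq D$ and $n\ge 1$, let $H_{D,n}$ be the finite $S$-labeled graph whose vertices are the injections $D\to n$, where for distinct $q,q'$ there is an edge labeled $\sigma\in S\cup S^{-1}$ from $q$ to $q'$ if and only if $q(\delta)=q'(\delta')$ for all $\delta,\delta'\in D$ with $\delta=\delta'\sigma$ (such a $\sigma$ is unique if it exists). **The families.** Let $\log^* n$ be the number of times the binary logarithm must be applied to $n$ before the result becomes at most $1$. Call $(F_i,n_i)_{i\ge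 1}$ admissible if $S\cup S^{-1}\cup\{\mathbf 1\}\subseteq F_1\subsetneq F_2\subsetneq\cdots$ are finite subsets of $\Gamma$ with $\bigcup_i F_i=\Gamma$, the $n_i\ge 1$ are integers with $n_i\ge |F_i|^{2\log^* n_i}$, and the sets $D_i:=F_i^{\log^* n_i}$ satisfy $S\cup S^{-1}\cup\{\mathbf 1\}\subseteq D_i$ (which is automatic if $n_i\ge 2$). **Theorem.** Admissible sequences exist. Let $(F_i,n_i)_{i\ge1}$ be any admissible sequence, and let $\mathscr H=(H_{D_i,n_i})_{i\ge 1}$. Then for every $k\ge 1$ and every finite set $\mathscr P$ of $S$-connected $k$-patterns the following statements are equivalent: 1. There is a continuous $\mathscr P$-avoiding $k$-coloring of $\mathrm{Free}(2^\Gamma)$. 2. Every free zero-dimensional Polish $\Gamma$-space admits a continuous $\mathscr P$-avoiding $k$-coloring. 3. There is an $i$ such that $H_{D_i,n_i}$ admits a $\mathscr P$-avoiding $k$-coloring. 4. For all but finitely many $i$, the graph $H_{D_i,n_i}$ admits a $\mathscr P$-avoiding $k$-coloring. -/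

import Mathlib

open scoped Pointwise

universe u v w

namespace ContinuousColoring



section Spaces

/-- A topological space is zero-dimensional if its clopen subsets form a base of the topology. -/
def ZeroDimensional (X : Type v) [TopologicalSpace X] : Prop :=
  TopologicalSpace.IsTopologicalBasis {U : Set X | IsClopen U}

/-- An action is free if all stabilizers are trivial. -/
def FreeAction (Γ : Type u) (X : Type v) [Group Γ] [MulAction Γ X] : Prop :=
  ∀ x : X, MulAction.stabilizer Γ x = ⊥

/-- The free part of a `Γ`-space: the invariant set of points with trivial stabilizer. As a type it
carries the subspace topology and the induced action. -/
def FreePart (Γ : Type u) (X : Type v) [Group Γ] [MulAction Γ X] : SubMulAction Γ X where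
  carrier := {x | MulAction.stabilizer Γ x = ⊥}
  smul_mem' := by
    intro c x hx
    have hx' : MulAction.stabilizer Γ x = ⊥ := hx
    change MulAction.stabilizer Γ (c • x) = ⊥
    rw [MulAction.stabilizer_smul_eq_stabilizer_map_conj, hx', Subgroup.map_bot]

/-- The Bernoulli shift `k^Γ`. -/
def Shift (Γ : Type u) (k : ℕ) : Type u := Γ → Fin k

/-- The product topology on `k^Γ`, where `k` is discrete. -/
instance Shift.instTopologicalSpace (Γ : Type u) (k : ℕ) : TopologicalSpace (Shift Γ k) :=
  inferInstanceAs (TopologicalSpace (Γ → Fin k))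

/-- The shift action `(γ • x) δ = x (δ γ)`. -/
instance Shift.instMulAction (Γ : Type u) [Group Γ] (k : ℕ) : MulAction Γ (Shift Γ k) where
  smul γ x := fun δ => x (δ * γ)
  one_smul x := funext fun δ => congrArg x (mul_one δ)
  mul_smul γ γ' x := funext fun δ => congrArg x (mul_assoc δ γ γ').symm

end Spaces

section Patterns

/-- A `k`-pattern: a partial map from `Γ` to `k` with finite domain. -/
structure Pattern (Γ : Type u) (k : ℕ) where
  /-- the domain -/
  dom : Finset Γ
  /-- the values -/
  val : dom → Fin k

/-- The pattern `p` occurs in the coloring `f` of a space with an action of `Γ`. -/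
def Pattern.Occurs {Γ : Type u} {k : ℕ} {X : Type v} [Group Γ] [MulAction Γ X]
    (p : Pattern Γ k) (f : X → Fin k) : Prop :=
  ∃ x : X, ∀ γ : p.dom, f ((γ : Γ) • x) = p.val γ

/-- The space `X` admits a continuous coloring with `k` colors that avoids all patterns in `P`. -/
def HasContinuousAvoidingColoring {Γ : Type u} {k : ℕ} (P : Set (Pattern Γ k)) (X : Type v)
    [TopologicalSpace X] [Group Γ] [MulAction Γ X] : Prop :=
  ∃ f : X → Fin k, Continuous f ∧ ∀ p ∈ P, ¬ p.Occurs f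

end Patterns

section LabeledGraphs

variable {Γ : Type u} [Group Γ] [DecidableEq Γ]

/-- An `S`-labeled graph on the vertex set `V`. Only the labels of ordered pairs of adjacent
vertices are meaningful. -/
structure LabeledGraph (S : Finset Γ) (V : Type v) where
  /-- the underlying simple graph -/
  graph : SimpleGraph V
  /-- the labeling map -/
  label : V → V → Γ
  label_mem : ∀ x y, graph.Adj x y → label x y ∈ S ∪ S⁻¹
  label_symm : ∀ x y, graph.Adj x y → label y x = (label x y)⁻¹

/-- The subgraph induced by a set of vertices. -/
def LabeledGraph.induce {S : Finset Γ} {V : Type v} (G : LabeledGraph S V) (U : Set V) :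
    LabeledGraph S U where
  graph := G.graph.induce U
  label x y := G.label x y
  label_mem x y h := G.label_mem x y h
  label_symm x y h := G.label_symm x y h

/-- Homomorphisms of `S`-labeled graphs. -/
def LabeledGraph.IsHom {S : Finset Γ} {V : Type v} {W : Type w} (G : LabeledGraph S V)
    (H : LabeledGraph S W) (φ : V → W) : Prop :=
  ∀ x y, G.graph.Adj x y →
    H.graph.Adj (φ x) (φ y) ∧ H.label (φ x) (φ y) = G.label x y

theorem inv_mem_union_inv {S : Finset Γ} {σ : Γ} (h : σ ∈ S ∪ S⁻¹) : σ⁻¹ ∈ S ∪ S⁻¹ := by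
  simp only [Finset.mem_union, Finset.mem_inv', inv_inv] at h ⊢
  exact h.symm

/-- The Cayley graph of `Γ`: an edge from `x` to `σ x` is labeled `σ`. -/
def cayleyGraph (S : Finset Γ) : LabeledGraph S Γ where
  graph :=
    { Adj := fun x y => x ≠ y ∧ ∃ σ ∈ S ∪ S⁻¹, y = σ * x
      symm := ⟨by
        rintro x y ⟨hne, σ, hσ, rfl⟩
        exact ⟨hne.symm, σ⁻¹, inv_mem_union_inv hσ, by simp⟩⟩
      loopless := ⟨fun x h => h.1 rfl⟩ }
  label x y := y * x⁻¹
  label_mem := by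
    rintro x y ⟨-, σ, hσ, rfl⟩
    simpa using hσ
  label_symm := by
    intro x y _
    simp

/-- A pattern is `S`-connected if its domain induces a connected (in particular nonempty) subgraph
of the Cayley graph. -/
def Pattern.SConnected {k : ℕ} (S : Finset Γ) (p : Pattern Γ k) : Prop :=
  ((cayleyGraph S).induce (p.dom : Set Γ)).graph.Connected

/-- The pattern `p` occurs in the coloring `f` of an `S`-labeled graph. -/
def Pattern.OccursIn {k : ℕ} {S : Finset Γ} {V : Type v} (p : Pattern Γ k)
    (G : LabeledGraph S V) (f : V → Fin k) : Prop :=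
  ∃ φ : p.dom → V, ((cayleyGraph S).induce (p.dom : Set Γ)).IsHom G φ ∧
    ∀ γ : p.dom, f (φ γ) = p.val γ

/-- The `S`-labeled graph `G` admits a coloring with `k` colors that avoids all patterns in `P`. -/
def LabeledGraph.HasAvoidingColoring {k : ℕ} {S : Finset Γ} {V : Type v}
    (G : LabeledGraph S V) (P : Set (Pattern Γ k)) : Prop :=
  ∃ f : V → Fin k, ∀ p ∈ P, ¬ p.OccursIn G f

end LabeledGraphs

section Tiles

variable {Γ : Type u} [Group Γ]

/-- The injections `q, q' : D → n` are `σ`-compatible. -/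
def Compatible {D : Finset Γ} {n : ℕ} (σ : Γ) (q q' : D ↪ Fin n) : Prop :=
  ∀ δ δ' : D, (δ : Γ) = δ' * σ → q δ = q' δ'

theorem Compatible.inv {D : Finset Γ} {n : ℕ} {σ : Γ} {q q' : D ↪ Fin n}
    (h : Compatible σ q q') : Compatible σ⁻¹ q' q := by
  intro δ δ' hδ
  exact (h δ' δ (by simp [hδ])).symm

variable [DecidableEq Γ]

theorem Compatible.unique {S D : Finset Γ} (hD : S ∪ S⁻¹ ∪ {1} ⊆ D) {n : ℕ} {σ τ : Γ}
    {q q' : D ↪ Fin n} (hσ : σ ∈ S ∪ S⁻¹) (hτ : τ ∈ S ∪ S⁻¹)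
    (h : Compatible σ q q') (h' : Compatible τ q q') : σ = τ := by
  have h1 : (1 : Γ) ∈ D := hD (by simp)
  have e := h ⟨σ, hD (Finset.mem_union_left _ hσ)⟩ ⟨1, h1⟩ (by simp)
  have e' := h' ⟨τ, hD (Finset.mem_union_left _ hτ)⟩ ⟨1, h1⟩ (by simp)
  exact congrArg Subtype.val (q.injective (e.trans e'.symm))

open Classical in
/-- The label of the ordered pair `(q, q')` in `H_{D,n}`: the element `σ` of `S ∪ S⁻¹` such that
`q` and `q'` are `σ`-compatible, if there is one (it is then unique), and a junk value otherwise. -/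
noncomputable def tileLabel (S : Finset Γ) {D : Finset Γ} {n : ℕ} (q q' : D ↪ Fin n) : Γ :=
  if h : ∃ σ ∈ S ∪ S⁻¹, Compatible σ q q' then h.choose else 1

theorem tileLabel_eq {S D : Finset Γ} (hD : S ∪ S⁻¹ ∪ {1} ⊆ D) {n : ℕ} {σ : Γ}
    {q q' : D ↪ Fin n} (hσ : σ ∈ S ∪ S⁻¹) (h : Compatible σ q q') :
    tileLabel S q q' = σ := by
  have hex : ∃ σ ∈ S ∪ S⁻¹, Compatible σ q q' := ⟨σ, hσ, h⟩
  rw [tileLabel, dif_pos hex]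
  exact Compatible.unique hD hex.choose_spec.1 hσ hex.choose_spec.2 h

/-- The finite `S`-labeled graph `H_{D,n}`. Its vertices are the injections `D → n`, and there is an
edge labeled `σ ∈ S ∪ S⁻¹` from `q` to `q'` if and only if they are `σ`-compatible. The graph has no
loops: the condition `q ≠ q'` discards only the label `1`, for which compatibility is equality. -/
noncomputable def tileGraph (S D : Finset Γ) (n : ℕ) (hD : S ∪ S⁻¹ ∪ {1} ⊆ D) :
    LabeledGraph S (D ↪ Fin n) where
  graph :=
    { Adj := fun q q' => q ≠ q' ∧ ∃ σ ∈ S ∪ S⁻¹, Compatible σ q q'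
      symm := ⟨by
        rintro q q' ⟨hne, σ, hσ, h⟩
        exact ⟨hne.symm, σ⁻¹, inv_mem_union_inv hσ, h.inv⟩⟩
      loopless := ⟨fun q h => h.1 rfl⟩ }
  label := tileLabel S
  label_mem := by
    rintro q q' ⟨-, σ, hσ, h⟩
    rw [tileLabel_eq hD hσ h]
    exact hσ
  label_symm := by
    rintro q q' ⟨-, σ, hσ, h⟩
    rw [tileLabel_eq hD hσ h, tileLabel_eq hD (inv_mem_union_inv hσ) h.inv]

/-- The iterated (binary) logarithm: the number of times the logarithm has to be applied to `n`
before the result becomes at most `1`. -/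
noncomputable def logStar (n : ℕ) : ℕ :=
  sInf {t : ℕ | (Real.logb 2)^[t] (n : ℝ) ≤ 1}

/-- The sequences of parameters that give rise to the families of graphs `H_{D_i, n_i}`, where
`D_i = F_i ^ (log* n_i)`. -/
structure IsTileSequence (S : Finset Γ) (F : ℕ → Finset Γ) (n : ℕ → ℕ) : Prop where
  base : S ∪ S⁻¹ ∪ {1} ⊆ F 0
  strictMono : StrictMono F
  exhausts : ∀ γ : Γ, ∃ i, γ ∈ F i
  one_le : ∀ i, 1 ≤ n i
  card_pow_le : ∀ i, (F i).card ^ (2 * logStar (n i)) ≤ n i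
  /-- The standing condition on `D` under which the graph `H_{D,n}` is defined. It is automatic if
  `n i ≥ 2`, since then `D_i` contains `F_i`. -/
  subset : ∀ i, S ∪ S⁻¹ ∪ {1} ⊆ F i ^ logStar (n i)

end Tiles

end ContinuousColoring

/-!
(1 ⇒ 2) Enumerate the elements `γ s ≠ 1` of `Γ`. There are finite sets `T s ⊆ Γ`, depending only on
the enumeration, such that every free zero-dimensional Lindelöf space has, for each `r`, a clopen
subset `b` whose indicator function has none of the periods `γ s`, `s < r`, along any orbit, as
witnessed at each point by a translate by an element of `T s`. The itinerary of `b` maps the space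
equivariantly to the closed subshift `Z r` of `2^Γ` cut out by these conditions. Since `⋂ r, Z r`
lies in the free part of `2^Γ`, compactness extends an avoiding coloring of the free part to some
`Z r`, from where it is pulled back. The set `b` is built period by period: the next period is
broken by repainting a sparse syndetic set of cells, each assigned to one of a set of sparser
markers, which are themselves left unpainted and serve as the cells of the next step. The new
values are chosen by a continuous local lemma, greedily along a locally constant rank.

(2 ⇒ 4) Apply (2) to the compact free space of families of `6`-colorings of `Γ` that are proper for
the translations by all `γ ≠ 1`. The resulting coloring depends on finitely many coordinates, and
`log* n` rounds of Cole–Vishkin color reduction compute these from a vertex `D → n` of `H_{D,n}`.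

(3 ⇒ 1) As `n ≥ |D|²`, a free zero-dimensional space has a continuous coloring by `n` colors that is
injective on all translates of `D`. Recording the colors along `D • x` maps each orbit to `H_{D,n}`.
-/

namespace ContinuousColoring

open Topology Filter

section LocallyConstant

variable {X : Type*} [TopologicalSpace X]

theorem isLocallyConstant_pi {ι : Type*} [Finite ι] {α : ι → Type*} {f : X → ∀ i, α i}
    (h : ∀ i, IsLocallyConstant fun x => f x i) : IsLocallyConstant f := by
  refine (IsLocallyConstant.iff_eventually_eq f).2 fun x => ?_
  filter_upwards [eventually_all.2 fun i => (h i).eventually_eq x] with y hy using funext hy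

theorem isLocallyConstant_forall {ι : Type*} [Finite ι] {p : X → ι → Prop}
    (h : ∀ i, IsLocallyConstant fun x => p x i) : IsLocallyConstant fun x => ∀ i, p x i :=
  (isLocallyConstant_pi h).comp fun q => ∀ i, q i

theorem isLocallyConstant_exists {ι : Type*} [Finite ι] {p : X → ι → Prop}
    (h : ∀ i, IsLocallyConstant fun x => p x i) : IsLocallyConstant fun x => ∃ i, p x i :=
  (isLocallyConstant_pi h).comp fun q => ∃ i, q i

theorem exists_isLocallyConstant_choice {ι : Type*} [Finite ι] {p : X → ι → Prop}
    (h : ∀ i, IsLocallyConstant fun x => p x i) (hp : ∀ x, ∃ i, p x i) :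
    ∃ c : X → ι, IsLocallyConstant c ∧ ∀ x, p x (c x) := by
  rcases isEmpty_or_nonempty X with hX | ⟨⟨x₀⟩⟩
  · exact ⟨isEmptyElim, IsLocallyConstant.of_discrete _, isEmptyElim⟩
  · have : Nonempty ι := ⟨(hp x₀).choose⟩
    exact ⟨fun x => Classical.epsilon (p x), (isLocallyConstant_pi h).comp Classical.epsilon,
      fun x => Classical.epsilon_spec (hp x)⟩

theorem isLocallyConstant_mem_iff {U : Set X} :
    (IsLocallyConstant fun x => x ∈ U) ↔ IsClopen U := by
  refine ⟨fun h => by simpa using h.isClopen_fiber True, fun h => ?_⟩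
  refine (IsLocallyConstant.iff_eventually_eq _).2 fun x => ?_
  by_cases hx : x ∈ U
  · filter_upwards [h.isOpen.mem_nhds hx] with y hy using by simp [hx, hy]
  · filter_upwards [h.compl.isOpen.mem_nhds hx] with y hy using by simpa [hx] using hy

theorem isLocallyConstant_find {p : ℕ → X → Prop} [∀ n x, Decidable (p n x)]
    (hp : ∀ n, IsLocallyConstant (p n)) (hex : ∀ x, ∃ n, p n x) :
    IsLocallyConstant fun x => Nat.find (hex x) := by
  refine (IsLocallyConstant.iff_eventually_eq _).2 fun x => ?_
  have h : ∀ᶠ y in 𝓝 x, ∀ m : Set.Iic (Nat.find (hex x)), p m y = p m x :=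
    eventually_all.2 fun m => (hp m).eventually_eq x
  filter_upwards [h] with y hy
  rw [Nat.find_eq_iff]
  refine ⟨?_, fun m hm => ?_⟩
  · rw [hy ⟨_, Set.mem_Iic.2 le_rfl⟩]
    exact Nat.find_spec (hex x)
  · rw [hy ⟨m, hm.le⟩]
    exact Nat.find_min (hex x) hm

end LocallyConstant

section GreedyColoring

variable {Γ X : Type*} [Group Γ] [MulAction Γ X]

theorem FreeAction.eq_one (h : FreeAction Γ X) {γ : Γ} {x : X} (hx : γ • x = x) : γ = 1 := by
  have : γ ∈ MulAction.stabilizer Γ x := hx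
  rwa [h x, Subgroup.mem_bot] at this

variable [TopologicalSpace X] [ContinuousConstSMul Γ X]

theorem isLocallyConstant_const_smul {α : Type*} {f : X → α} (hf : IsLocallyConstant f) (γ : Γ) :
    IsLocallyConstant fun x => f (γ • x) :=
  hf.comp_continuous (continuous_const_smul γ)

theorem isLocallyConstant_smul {α : Type*} {f : X → α} {a : X → Γ} (ha : IsLocallyConstant a)
    (hf : IsLocallyConstant f) : IsLocallyConstant fun x => f (a x • x) := by
  refine (IsLocallyConstant.iff_eventually_eq _).2 fun x => ?_
  filter_upwards [ha.eventually_eq x, (isLocallyConstant_const_smul hf (a x)).eventually_eq x]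
    with y hay hfy
  rw [hay, hfy]

theorem exists_greedy {V : Type*} (N : Finset Γ) {ρ : X → ℕ} (hρ : IsLocallyConstant ρ)
    {Φ : X → (N → Option V) → V} (hΦ : IsLocallyConstant Φ) :
    ∃ c : X → V, IsLocallyConstant c ∧ ∀ x, c x = Φ x fun γ =>
      if ρ ((γ : Γ) • x) < ρ x then some (c ((γ : Γ) • x)) else none := by
  let F (x : X) (ih : ∀ y, ρ y < ρ x → V) : V := Φ x fun γ =>
    if h : ρ ((γ : Γ) • x) < ρ x then some (ih ((γ : Γ) • x) h) else none
  let c : X → V := (measure ρ).wf.fix F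
  have hc : ∀ x, c x = Φ x fun γ =>
      if ρ ((γ : Γ) • x) < ρ x then some (c ((γ : Γ) • x)) else none :=
    fun x => (measure ρ).wf.fix_eq F x
  refine ⟨c, (IsLocallyConstant.iff_eventually_eq _).2 fun x => ?_, hc⟩
  induction x using (measure ρ).wf.induction with
  | _ x ih =>
    have rank_eq : ∀ᶠ y in 𝓝 x, ∀ γ : N, ρ ((γ : Γ) • y) = ρ ((γ : Γ) • x) :=
      eventually_all.2 fun γ => (isLocallyConstant_const_smul hρ (γ : Γ)).eventually_eq x
    have value_eq : ∀ᶠ y in 𝓝 x, ∀ γ : N, ρ ((γ : Γ) • x) < ρ x →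
        c ((γ : Γ) • y) = c ((γ : Γ) • x) :=
      eventually_all.2 fun γ => eventually_imp_distrib_left.2 fun h =>
        (continuous_const_smul (γ : Γ)).continuousAt.eventually (ih _ h)
    filter_upwards [rank_eq, value_eq, hρ.eventually_eq x, hΦ.eventually_eq x]
      with y rank_eq value_eq hρy hΦy
    rw [hc y, hc x, hΦy]
    congr 1
    funext γ
    rw [rank_eq, hρy]
    split_ifs with h
    · rw [value_eq γ h]
    · rfl

theorem exists_isClopen_smul_notMem [T2Space X] (hX : ZeroDimensional X) (hfree : FreeAction Γ X)
    (R : Finset Γ) (x : X) :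
    ∃ U : Set X, IsClopen U ∧ x ∈ U ∧ ∀ γ ∈ R, γ ≠ 1 → ∀ y ∈ U, γ • y ∉ U := by
  have moved : ∀ᶠ p : X × X in 𝓝 x ×ˢ 𝓝 x, ∀ γ ∈ R, γ ≠ 1 → γ • p.1 ≠ p.2 := by
    refine (Finset.eventually_all R).2 fun γ _ => eventually_imp_distrib_left.2 fun hγ => ?_
    rw [← nhds_prod_eq]
    exact (isOpen_ne_fun ((continuous_const_smul γ).comp continuous_fst)
      continuous_snd).mem_nhds fun h => hγ (hfree.eq_one h)
  obtain ⟨W, hW, hWR⟩ := eventually_prod_self_iff'.1 moved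
  obtain ⟨U, hU, hxU, hUW⟩ := hX.mem_nhds_iff.1 hW
  exact ⟨U, hU, hxU, fun γ hγ h1 y hy hy' => hWR y (hUW hy) _ (hUW hy') γ hγ h1 rfl⟩

theorem exists_rank [LindelofSpace X] [T2Space X] (hX : ZeroDimensional X)
    (hfree : FreeAction Γ X) (R : Finset Γ) :
    ∃ ρ : X → ℕ, IsLocallyConstant ρ ∧ ∀ x, ∀ γ ∈ R, γ ≠ 1 → ρ (γ • x) ≠ ρ x := by
  classical
  rcases isEmpty_or_nonempty X with hX | hne
  · exact ⟨fun _ => 0, IsLocallyConstant.const 0, isEmptyElim⟩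
  choose U hU hxU hUR using exists_isClopen_smul_notMem hX hfree R
  obtain ⟨s, hs, hcover⟩ :=
    LindelofSpace.elim_nhds_subcover U fun x => (hU x).isOpen.mem_nhds (hxU x)
  have hmem : ∀ x, ∃ z ∈ s, x ∈ U z := by
    simpa only [Set.iUnion_eq_univ_iff, Set.mem_iUnion, exists_prop] using hcover
  have hs_ne : s.Nonempty := (hmem hne.some).imp fun _ h => h.1
  obtain ⟨e, rfl⟩ := hs.exists_eq_range hs_ne
  have hex : ∀ x, ∃ n, x ∈ U (e n) := by simpa only [Set.exists_range_iff] using hmem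
  refine ⟨fun x => Nat.find (hex x),
    isLocallyConstant_find (fun n => isLocallyConstant_mem_iff.2 (hU (e n))) hex,
    fun x γ hγ h1 heq => ?_⟩
  refine hUR (e (Nat.find (hex x))) γ hγ h1 x (Nat.find_spec (hex x)) ?_
  simp only at heq
  rw [← heq]
  exact Nat.find_spec (hex (γ • x))

theorem exists_forall_ne_some {ι V : Type*} [Fintype ι] [Fintype V]
    (h : Fintype.card ι < Fintype.card V) (o : ι → Option V) : ∃ v, ∀ i, o i ≠ some v := by
  by_contra! hall
  choose g hg using hall
  refine h.not_ge (Fintype.card_le_of_injective g fun v w hvw => ?_)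
  exact Option.some_injective _ ((hg v).symm.trans (hvw ▸ hg w))

theorem exists_proper_coloring [LindelofSpace X] [T2Space X] [DecidableEq Γ]
    (hX : ZeroDimensional X) (hfree : FreeAction Γ X) (R : Finset Γ) (hR : ∀ γ ∈ R, γ⁻¹ ∈ R)
    {V : Type*} [Fintype V] (hV : (R.erase 1).card < Fintype.card V) :
    ∃ c : X → V, IsLocallyConstant c ∧ ∀ x, ∀ γ ∈ R, γ ≠ 1 → c (γ • x) ≠ c x := by
  obtain ⟨ρ, hρ, hρR⟩ := exists_rank hX hfree R
  choose fresh hfresh using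
    exists_forall_ne_some (ι := R.erase 1) (V := V) (by rwa [Fintype.card_coe])
  obtain ⟨c, hc, hcx⟩ :=
    exists_greedy (R.erase 1) hρ (Φ := fun _ => fresh) (IsLocallyConstant.const fresh)
  have ne_of_lt : ∀ x, ∀ γ ∈ R, γ ≠ 1 → ρ (γ • x) < ρ x → c (γ • x) ≠ c x := by
    intro x γ hγ h1 hlt heq
    have h := hfresh (fun γ => if ρ ((γ : Γ) • x) < ρ x then some (c ((γ : Γ) • x)) else none)
      ⟨γ, Finset.mem_erase.2 ⟨h1, hγ⟩⟩
    rw [if_pos hlt, ← hcx x] at h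
    exact h (congrArg some heq)
  refine ⟨c, hc, fun x γ hγ h1 => ?_⟩
  rcases lt_or_gt_of_ne (hρR x γ hγ h1) with h | h
  · exact ne_of_lt x γ hγ h1 h
  · simpa using (ne_of_lt (γ • x) γ⁻¹ (hR γ hγ) (by simpa using h1) (by simpa using h)).symm

end GreedyColoring

section SyndeticSets

variable {Γ X : Type*} [Group Γ] [MulAction Γ X]

/-- Syndeticity with witness `E`: every point is moved into `B` by an element of `E`. -/
def IsSyndetic (E : Finset Γ) (B : Set X) : Prop :=
  ∀ x, ∃ γ ∈ E, γ • x ∈ B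

/-- Separation with respect to `A`: distinct points of `B` never differ by an element of `A`. -/
def IsSeparatedBy (A : Finset Γ) (B : Set X) : Prop :=
  ∀ x ∈ B, ∀ γ ∈ A, γ • x ∈ B → γ = 1

variable [TopologicalSpace X] [ContinuousConstSMul Γ X]

theorem exists_maximal_isSeparatedBy [LindelofSpace X] [T2Space X] (hX : ZeroDimensional X)
    (hfree : FreeAction Γ X) {A : Finset Γ} (h1 : 1 ∈ A) (hA : ∀ γ ∈ A, γ⁻¹ ∈ A) {B : Set X}
    (hB : IsClopen B) :
    ∃ B' ⊆ B, IsClopen B' ∧ IsSeparatedBy A B' ∧ ∀ x ∈ B, ∃ γ ∈ A, γ • x ∈ B' := by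
  obtain ⟨ρ, hρ, hρA⟩ := exists_rank hX hfree A
  obtain ⟨c, hc, hcx⟩ := exists_greedy A hρ (V := Prop)
    (Φ := fun x (o : A → Option Prop) => x ∈ B ∧ ∀ γ, o γ ≠ some True)
    ((isLocallyConstant_mem_iff.2 hB).comp fun p (o : A → Option Prop) => p ∧ ∀ γ, o γ ≠ some True)
  have hcx : ∀ x, c x ↔ x ∈ B ∧ ∀ γ ∈ A, ρ (γ • x) < ρ x → ¬ c (γ • x) := by
    intro x
    simp only [hcx x, Subtype.forall]
    simp
  have not_of_lt : ∀ x, c x → ∀ γ ∈ A, c (γ • x) → ¬ ρ (γ • x) < ρ x :=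
    fun x hx γ hγ hγx hlt => ((hcx x).1 hx).2 γ hγ hlt hγx
  refine ⟨{x | c x}, fun x hx => ((hcx x).1 hx).1, isLocallyConstant_mem_iff.1 hc, ?_, ?_⟩
  · intro x hx γ hγ hγx
    by_contra hne
    rcases lt_or_gt_of_ne (hρA x γ hγ hne) with hlt | hlt
    · exact not_of_lt x hx γ hγ hγx hlt
    · exact not_of_lt (γ • x) hγx γ⁻¹ (hA γ hγ) (by simpa using hx) (by simpa using hlt)
  · intro x hx
    by_cases hcx' : c x
    · exact ⟨1, h1, by simpa using hcx'⟩
    · have := mt (fun h => (hcx x).2 ⟨hx, h⟩) hcx'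
      push Not at this
      exact this.imp fun γ h => ⟨h.1, h.2.2⟩

end SyndeticSets

section Counting

theorem ncard_le_two_pow {ι : Type*} [Finite ι] (r : ι → ι → Prop) [IsWellFounded ι r]
    {s : Set (Set ι)} {H : Set ι}
    (h : ∀ i ∉ H, (∃ b : Prop, ∀ v ∈ s, i ∈ v ↔ b) ∨ ∃ j, r j i ∧ ∀ v ∈ s, i ∈ v ↔ j ∈ v) :
    s.ncard ≤ 2 ^ H.ncard := by
  rw [← Set.ncard_powerset]
  refine Set.ncard_le_ncard_of_injOn (· ∩ H) (fun v _ => Set.inter_subset_right)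
    (fun v hv v' hv' heq => Set.ext fun i => ?_)
  induction i using IsWellFounded.induction r with
  | _ i ih =>
    by_cases hi : i ∈ H
    · simpa [hi] using Set.ext_iff.1 heq i
    · rcases h i hi with ⟨b, hb⟩ | ⟨j, hj, hb⟩
      · rw [hb v hv, hb v' hv']
      · rw [hb v hv, hb v' hv', ih j hj]

theorem ncard_sq_le_two_pow_of_linked {ι : Type*} [Finite ι] {s : Set (Set ι)} {G : Set ι}
    (h : ∀ i ∈ G, (∃ b : Prop, ∀ v ∈ s, i ∈ v ↔ b) ∨ ∃ j, j ≠ i ∧ ∀ v ∈ s, i ∈ v ↔ j ∈ v) :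
    s.ncard ^ 2 ≤ 2 ^ (Nat.card ι + Gᶜ.ncard) := by
  obtain ⟨n, ⟨e⟩⟩ := Finite.exists_equiv_fin ι
  let := LinearOrder.lift' e e.injective
  have : WellFoundedLT ι := Finite.to_wellFoundedLT
  have : WellFoundedGT ι := Finite.to_wellFoundedGT
  let p : Set ι := {i | (∃ b : Prop, ∀ v ∈ s, i ∈ v ↔ b) ∨ ∃ j, j < i ∧ ∀ v ∈ s, i ∈ v ↔ j ∈ v}
  have below : s.ncard ≤ 2 ^ (Gᶜ ∪ pᶜ).ncard := by
    refine ncard_le_two_pow (· < ·) fun i hi => ?_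
    simp only [Set.mem_union, Set.mem_compl_iff, not_or, not_not] at hi
    exact hi.2
  have above : s.ncard ≤ 2 ^ (Gᶜ ∪ p).ncard := by
    refine ncard_le_two_pow (· > ·) fun i hi => ?_
    simp only [Set.mem_union, Set.mem_compl_iff, not_or, not_not] at hi
    refine (h i hi.1).imp_right fun ⟨j, hne, hj⟩ => ⟨j, ?_, hj⟩
    exact lt_of_le_of_ne (le_of_not_gt fun hlt => hi.2 (Or.inr ⟨j, hlt, hj⟩)) hne.symm
  have hcard : (Gᶜ ∪ pᶜ).ncard + (Gᶜ ∪ p).ncard = Nat.card ι + Gᶜ.ncard := by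
    rw [← Set.ncard_union_add_ncard_inter, ← Set.union_inter_distrib_left, Set.compl_inter_self,
      Set.union_empty, ← Set.union_union_distrib_left, Set.compl_union_self, Set.union_univ,
      Set.ncard_univ]
  rw [← hcard, pow_add, sq]
  exact Nat.mul_le_mul below above

theorem ncard_mul_le_of_forall_ncard_le {V W : Type*} [Finite V] [Finite W] {r : V → W → Prop}
    {d : ℕ} (h : ∀ w, {v | r v w}.ncard ≤ d) (m : ℕ) :
    {v | m < {w | r v w}.ncard}.ncard * (m + 1) ≤ d * Nat.card W := by
  classical
  have := Fintype.ofFinite V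
  have := Fintype.ofFinite W
  rw [Set.ncard_eq_toFinset_card', Nat.card_eq_fintype_card, mul_comm d]
  refine Finset.card_mul_le_card_mul r (t := Finset.univ) (fun v hv => ?_) fun w _ => ?_
  · rw [Set.mem_toFinset, Set.mem_ofPred_eq, Set.ncard_eq_toFinset_card'] at hv
    simpa [Finset.bipartiteAbove, Nat.succ_le_iff] using hv
  · refine le_trans (Finset.card_le_card fun v hv => ?_)
      ((Set.ncard_eq_toFinset_card' {v | r v w}).symm.trans_le (h w))
    simpa using ((Finset.mem_bipartiteBelow r).1 hv).2

theorem ncard_setOf_exists_mem_le {ι V : Type*} [Finite V] (t : Finset ι) {s : ι → Set V} {d : ℕ}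
    (h : ∀ i ∈ t, (s i).ncard ≤ d) : {v | ∃ i ∈ t, v ∈ s i}.ncard ≤ t.card * d := by
  have hU : {v | ∃ i ∈ t, v ∈ s i} = ⋃ i ∈ t, s i := by ext; simp
  rw [hU]
  exact (Finset.set_ncard_biUnion_le t s).trans (Finset.sum_le_card_nsmul t _ d h)

end Counting

section Assignment

/-- The greedy rule of the continuous local lemma: `v` is a safe value for a variable whose
neighbors are indexed by `ι`. It lies outside the set `s` of values that fail on their own, and for
each neighbor `η` it rules out at most `m` values `w` there by a failure `f η v w`. If the neighbor
already has the value `w`, then neither constraint between the two fails; the constraint `f' η`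
seen from the neighbor only has to be respected if `w` obeyed the rule. -/
def IsSafe {ι V : Type*} (m : ℕ) (s : Set V) (f f' : ι → V → V → Prop) (o : ι → Option V)
    (v : V) : Prop :=
  v ∉ s ∧ ∀ η, {w | f η v w}.ncard ≤ m ∧
    ∀ w ∈ o η, ¬ f η v w ∧ ({u | f' η w u}.ncard ≤ m → ¬ f' η w v)

theorem exists_isSafe {ι V : Type*} [Fintype ι] [Finite V] {a d m : ℕ} {s : Set V}
    {f : ι → V → V → Prop} (hs : s.ncard ≤ a) (hf : ∀ η w, {v | f η v w}.ncard ≤ d)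
    (hcard : a + Fintype.card ι * (d * Nat.card V / (m + 1) + d + m) < Nat.card V)
    (f' : ι → V → V → Prop) (o : ι → Option V) : ∃ v, IsSafe m s f f' o v := by
  let greedy : ι → Set V := fun η => {v | m < {w | f η v w}.ncard}
  let failing : ι → Set V := fun η => {v | ∃ w ∈ o η, f η v w}
  let failing' : ι → Set V := fun η => {v | ∃ w ∈ o η, {u | f' η w u}.ncard ≤ m ∧ f' η w v}
  have hgreedy : ∀ η, (greedy η).ncard ≤ d * Nat.card V / (m + 1) := fun η =>
    (Nat.le_div_iff_mul_le m.succ_pos).2 (ncard_mul_le_of_forall_ncard_le (hf η) m)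
  have hfailing : ∀ η, (failing η).ncard ≤ d := by
    intro η
    cases ho : o η with
    | none => simp [failing, ho]
    | some w => simpa [failing, ho] using hf η w
  have hfailing' : ∀ η, (failing' η).ncard ≤ m := by
    intro η
    cases ho : o η with
    | none => simp [failing', ho]
    | some w => by_cases hw : {u | f' η w u}.ncard ≤ m <;> simp [failing', ho, hw]
  have hbad : (s ∪ {v | ∃ η ∈ Finset.univ, v ∈ greedy η ∪ failing η ∪ failing' η}).ncard <
      Nat.card V := by
    refine ((Set.ncard_union_le _ _).trans (add_le_add hs
      (ncard_setOf_exists_mem_le Finset.univ fun η _ => ?_))).trans_lt hcard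
    exact (Set.ncard_union_le _ _).trans (add_le_add ((Set.ncard_union_le _ _).trans
      (add_le_add (hgreedy η) (hfailing η))) (hfailing' η))
  obtain ⟨v, hv⟩ : ∃ v, v ∉ s ∪ {v | ∃ η ∈ Finset.univ, v ∈ greedy η ∪ failing η ∪ failing' η} := by
    by_contra! hall
    rw [Set.eq_univ_iff_forall.2 hall, Set.ncard_univ] at hbad
    exact lt_irrefl _ hbad
  simp only [greedy, failing, failing', Set.mem_union, Set.mem_ofPred_eq, Finset.mem_univ, true_and,
    not_or, not_exists, not_and, not_lt] at hv
  exact ⟨v, hv.1, fun η => ⟨(hv.2 η).1.1, fun w hw => ⟨(hv.2 η).1.2 w hw, (hv.2 η).2 w hw⟩⟩⟩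

variable {Γ X : Type*} [Group Γ] [TopologicalSpace X] [MulAction Γ X] [ContinuousConstSMul Γ X]

theorem exists_isLocallyConstant_isSafe {V : Type*} [Finite V] [Nonempty V] (N : Finset Γ)
    {ρ : X → ℕ} (hρ : IsLocallyConstant ρ) (m : ℕ) {fail : X → Γ → V → V → Prop}
    (hfail : ∀ η v w, IsLocallyConstant fun x => fail x η v w) :
    ∃ φ : X → V, IsLocallyConstant φ ∧ ∀ x,
      let safe := IsSafe m {v | fail x 1 v v} (fun η : N => fail x η)
        (fun η : N => fail ((η : Γ) • x) (η : Γ)⁻¹)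
        fun η => if ρ ((η : Γ) • x) < ρ x then some (φ ((η : Γ) • x)) else none
      (∃ v, safe v) → safe (φ x) := by
  have hs : IsLocallyConstant fun x v => fail x 1 v v := isLocallyConstant_pi fun v => hfail 1 v v
  have hf : IsLocallyConstant fun x (η : N) => fail x η :=
    isLocallyConstant_pi fun η => isLocallyConstant_pi fun v => isLocallyConstant_pi (hfail η v)
  have hf' : IsLocallyConstant fun x (η : N) => fail ((η : Γ) • x) (η : Γ)⁻¹ :=
    isLocallyConstant_pi fun η => isLocallyConstant_pi fun v => isLocallyConstant_pi fun w =>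
      isLocallyConstant_const_smul (hfail (η : Γ)⁻¹ v w) (η : Γ)
  obtain ⟨φ, hφ, hφx⟩ := exists_greedy N hρ ((hs.prodMk (hf.prodMk hf')).comp
    fun t o => Classical.epsilon (IsSafe m {v | t.1 v} t.2.1 t.2.2 o))
  refine ⟨φ, hφ, fun x hsafe => ?_⟩
  rw [hφx x]
  exact Classical.epsilon_spec hsafe

/-- A continuous local lemma for binary constraints, where the constraint between `x` and itself is
that of `η = 1`. -/
theorem exists_assignment {V : Type*} [Finite V] {N : Finset Γ} (hN : ∀ η ∈ N, η⁻¹ ∈ N)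
    {ρ : X → ℕ} (hρ : IsLocallyConstant ρ) (hρN : ∀ x, ∀ η ∈ N, η ≠ 1 → ρ (η • x) ≠ ρ x)
    {M : Set X} {fail : X → Γ → V → V → Prop}
    (hfail : ∀ η v w, IsLocallyConstant fun x => fail x η v w) {a d m : ℕ}
    (hself : ∀ x ∈ M, {v | fail x 1 v v}.ncard ≤ a)
    (hpair : ∀ x ∈ M, ∀ η w, {v | fail x η v w}.ncard ≤ d)
    (hcard : a + N.card * (d * Nat.card V / (m + 1) + d + m) < Nat.card V) :
    ∃ φ : X → V, IsLocallyConstant φ ∧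
      ∀ x ∈ M, ∀ η ∈ N, η • x ∈ M → ¬ fail x η (φ x) (φ (η • x)) := by
  have : Nonempty V := Finite.card_pos_iff.1 (by omega)
  obtain ⟨φ, hφ, hsafe⟩ := exists_isLocallyConstant_isSafe N hρ m hfail
  replace hsafe := fun x (hx : x ∈ M) => hsafe x (exists_isSafe (hself x hx)
    (fun (η : N) w => hpair x hx η w) (by rwa [Fintype.card_coe]) _ _)
  refine ⟨φ, hφ, fun x hx η hη hηx hbad => ?_⟩
  by_cases h1 : η = 1
  · subst h1
    rw [one_smul] at hbad
    exact (hsafe x hx).1 hbad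
  rcases lt_or_gt_of_ne (hρN x η hη h1) with hlt | hlt
  · exact (((hsafe x hx).2 ⟨η, hη⟩).2 (φ (η • x)) (if_pos hlt)).1 hbad
  · have hx' := ((hsafe (η • x) hηx).2 ⟨η⁻¹, hN η hη⟩).2 (φ x) (by simp [hlt])
    simp only [inv_smul_smul, inv_inv] at hx'
    exact hx'.2 ((hsafe x hx).2 ⟨η, hη⟩).1 hbad

end Assignment

section Windows

variable {Γ : Type*} [Group Γ]

theorem exists_pow_mul_lt_two_pow (K d : ℕ) : ∃ l : ℕ, 1 ≤ l ∧ K * l ^ d < 2 ^ l := by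
  have h := tendsto_pow_const_div_const_pow_of_one_lt d (r := (2 : ℝ)) (by norm_num)
  obtain ⟨l, hl, hl1⟩ := ((h.eventually (gt_mem_nhds
    (show (0 : ℝ) < 1 / (K + 1) by positivity))).and (eventually_ge_atTop 1)).exists
  refine ⟨l, hl1, ?_⟩
  rw [div_lt_div_iff₀ (by positivity) (by positivity)] at hl
  have hlt : ((K + 1 : ℕ) * l ^ d : ℝ) < 2 ^ l := by push_cast; linarith
  have hlt : (K + 1) * l ^ d < 2 ^ l := by exact_mod_cast hlt
  exact (Nat.mul_le_mul_right _ K.le_succ).trans_lt hlt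

theorem exists_seq_disjoint_translates [Infinite Γ] (E : Finset Γ) :
    ∃ g : ℕ → Γ, ∀ i j, ∀ e ∈ E, ∀ e' ∈ E, e * g i = e' * g j → i = j := by
  classical
  let r : Γ → Γ → Prop := fun x y => ∀ e ∈ E, ∀ e' ∈ E, e * x ≠ e' * y
  have : Std.Symm r := ⟨fun x y h e he e' he' heq => h e' he' e he heq.symm⟩
  obtain ⟨g, -, hg⟩ := exists_seq_of_forall_finset_exists' (fun _ : Γ => True) r fun s _ => by
    obtain ⟨y, hy⟩ := Infinite.exists_notMem_finset (E⁻¹ * E * s)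
    refine ⟨y, trivial, fun x hx e he e' he' heq => hy ?_⟩
    rw [show y = e'⁻¹ * e * x by rw [mul_assoc, heq, inv_mul_cancel_left]]
    exact Finset.mul_mem_mul (Finset.mul_mem_mul (Finset.inv_mem_inv he') he) hx
  exact ⟨g, fun i j e he e' he' heq => by_contra fun hij => hg hij e he e' he' heq⟩

variable [DecidableEq Γ]

/-- The window in which markers are separated, when the cells of a marker `y` are points `q • y`
with `q ∈ Q`. -/
def markerWindow (Q : Finset Γ) : Finset Γ :=
  (Q ∪ Q⁻¹) ^ 4

/-- The conjugates of `γ` that arise if an arbitrary point is moved to a marker by an element of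
`markerWindow Q * E`. -/
def conjugateWindow (E Q : Finset Γ) (γ : Γ) : Finset Γ :=
  (markerWindow Q * E).image fun t => t * γ * t⁻¹

/-- The window in which the cells of a marker, translated by elements of `C`, can meet cells of
another marker. -/
def partnerWindow (Q C : Finset Γ) : Finset Γ :=
  insert 1 (Q⁻¹ * Q * C ∪ (Q⁻¹ * Q * C)⁻¹)

theorem inv_mem_pow_union_inv {Q : Finset Γ} {α : Γ} (n : ℕ) (hα : α ∈ (Q ∪ Q⁻¹) ^ n) :
    α⁻¹ ∈ (Q ∪ Q⁻¹) ^ n := by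
  have hsymm : (Q ∪ Q⁻¹)⁻¹ = Q ∪ Q⁻¹ := by
    ext x
    simp only [Finset.mem_inv', Finset.mem_union, inv_inv, or_comm]
  rw [← hsymm, inv_pow]
  exact Finset.inv_mem_inv hα

theorem mul_mul_mul_mem_markerWindow {Q : Finset Γ} {q₁ q₂ q₃ q₄ : Γ} (h₁ : q₁ ∈ Q ∪ Q⁻¹)
    (h₂ : q₂ ∈ Q ∪ Q⁻¹) (h₃ : q₃ ∈ Q ∪ Q⁻¹) (h₄ : q₄ ∈ Q ∪ Q⁻¹) :
    q₁ * q₂ * (q₃ * q₄) ∈ markerWindow Q := by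
  rw [markerWindow, pow_succ _ 3, pow_succ _ 2, pow_two, ← mul_assoc]
  exact Finset.mul_mem_mul (Finset.mul_mem_mul (Finset.mul_mem_mul h₁ h₂) h₃) h₄

theorem mul_mem_markerWindow {Q : Finset Γ} {q₁ q₂ : Γ} (h₁ : q₁ ∈ Q ∪ Q⁻¹) (h₂ : q₂ ∈ Q ∪ Q⁻¹) :
    q₁ * q₂ ∈ markerWindow Q := by
  have hinv : q₁⁻¹ ∈ Q ∪ Q⁻¹ := by
    simpa only [pow_one] using inv_mem_pow_union_inv (Q := Q) 1 (by rwa [pow_one])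
  simpa using mul_mul_mul_mem_markerWindow h₁ h₂ h₁ hinv

theorem one_mem_markerWindow {Q : Finset Γ} (hQ : Q.Nonempty) : 1 ∈ markerWindow Q := by
  obtain ⟨q, hq⟩ := hQ
  simpa using mul_mem_markerWindow (Finset.mem_union_left _ hq)
    (Finset.mem_union_right _ (Finset.inv_mem_inv hq))

theorem inv_mem_partnerWindow {Q C : Finset Γ} {η : Γ} (h : η ∈ partnerWindow Q C) :
    η⁻¹ ∈ partnerWindow Q C := by
  simp only [partnerWindow, Finset.mem_insert, Finset.mem_union, Finset.mem_inv', inv_eq_one,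
    inv_inv] at h ⊢
  exact h.imp_right Or.symm

theorem card_markerWindow_le (Q : Finset Γ) : (markerWindow Q).card ≤ (2 * Q.card) ^ 4 := by
  refine Finset.card_pow_le.trans (Nat.pow_le_pow_left ?_ 4)
  refine (Finset.card_union_le _ _).trans ?_
  rw [Finset.card_inv, two_mul]

theorem card_partnerWindow_le (Q C : Finset Γ) :
    (partnerWindow Q C).card ≤ 2 * (Q.card ^ 2 * C.card) + 1 := by
  have hprod : (Q⁻¹ * Q * C).card ≤ Q.card ^ 2 * C.card := by
    refine Finset.card_mul_le.trans (Nat.mul_le_mul_right _ (Finset.card_mul_le.trans ?_))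
    rw [Finset.card_inv, sq]
  refine (Finset.card_insert_le _ _).trans (Nat.succ_le_succ ((Finset.card_union_le _ _).trans ?_))
  rw [Finset.card_inv]
  omega

theorem exists_scale {E : Finset Γ} (hE : E.Nonempty) (γ : Γ) :
    ∃ l, 1 ≤ l ∧ ∀ Q : Finset Γ, Q.Nonempty → Q.card ≤ E.card * (2 * l) →
      11 * ((conjugateWindow E Q γ).card * (partnerWindow Q (conjugateWindow E Q γ)).card) <
        2 ^ l := by
  obtain ⟨l, hl, hlK⟩ :=
    exists_pow_mul_lt_two_pow (33 * 2 ^ 8 * (2 * E.card) ^ 10 * E.card ^ 2) 10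
  refine ⟨l, hl, fun Q hQne hQ => lt_of_le_of_lt ?_ hlK⟩
  set C := conjugateWindow E Q γ
  have hC : C.card ≤ (2 * Q.card) ^ 4 * E.card := Finset.card_image_le.trans
    (Finset.card_mul_le.trans (Nat.mul_le_mul_right _ (card_markerWindow_le Q)))
  have hCne : C.Nonempty := (Finset.Nonempty.mul ⟨1, one_mem_markerWindow hQne⟩ hE).image _
  have hN : (partnerWindow Q C).card ≤ 3 * (Q.card ^ 2 * C.card) := by
    have := Nat.mul_pos (pow_pos hQne.card_pos 2) hCne.card_pos
    have := card_partnerWindow_le Q C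
    omega
  calc 11 * (C.card * (partnerWindow Q C).card)
      ≤ 11 * (C.card * (3 * (Q.card ^ 2 * C.card))) := by gcongr
    _ = 33 * Q.card ^ 2 * C.card ^ 2 := by ring
    _ ≤ 33 * Q.card ^ 2 * ((2 * Q.card) ^ 4 * E.card) ^ 2 := by gcongr
    _ = 33 * 2 ^ 8 * Q.card ^ 10 * E.card ^ 2 := by ring
    _ ≤ 33 * 2 ^ 8 * (E.card * (2 * l)) ^ 10 * E.card ^ 2 := by gcongr
    _ = 33 * 2 ^ 8 * (2 * E.card) ^ 10 * E.card ^ 2 * l ^ 10 := by ring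

end Windows

section Cells

theorem exists_partner {Γ X : Type*} [Group Γ] [MulAction Γ X] [DecidableEq Γ] {B' : Set X}
    {Q C : Finset Γ} {x : X} {c : Γ} (hB' : IsSeparatedBy (markerWindow Q) B') (hx : x ∈ B')
    (hc : c ∈ C) :
    ∃ η ∈ partnerWindow Q C, η • x ∈ B' ∧
      ∀ q ∈ Q, ∀ q' ∈ Q, (q⁻¹ * (q' * c)) • x ∈ B' → q⁻¹ * (q' * c) = η := by
  by_cases h : ∃ q ∈ Q, ∃ q' ∈ Q, (q⁻¹ * (q' * c)) • x ∈ B'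
  · obtain ⟨q₁, hq₁, q₂, hq₂, hmem⟩ := h
    refine ⟨_, ?_, hmem, fun q hq q' hq' hqx => ?_⟩
    · rw [← mul_assoc, partnerWindow]
      exact Finset.mem_insert_of_mem (Finset.mem_union_left _ (Finset.mul_mem_mul
        (Finset.mul_mem_mul (Finset.inv_mem_inv hq₁) hq₂) hc))
    · have hmul : q⁻¹ * (q' * c) = q⁻¹ * q' * (q₂⁻¹ * q₁) * (q₁⁻¹ * (q₂ * c)) := by group
      rw [hmul, mul_smul] at hqx
      have h1 := hB' _ hmem _ (mul_mul_mul_mem_markerWindow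
        (Finset.mem_union_right _ (Finset.inv_mem_inv hq)) (Finset.mem_union_left _ hq')
        (Finset.mem_union_right _ (Finset.inv_mem_inv hq₂)) (Finset.mem_union_left _ hq₁)) hqx
      rw [hmul, h1, one_mul]
  · push Not at h
    exact ⟨1, Finset.mem_insert_self _ _, by rwa [one_smul],
      fun q hq q' hq' hqx => absurd hqx (h q hq q' hq')⟩

/-- Every point of the space owns cells indexed by `ι`: locally constant choices of points of `B` in
its orbit, at positions from `Q`, such that cells with different indices have different positions
even if they are owned by different points. -/
structure CellSystem {Γ X : Type*} [Group Γ] [MulAction Γ X] [TopologicalSpace X] (B : Set X)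
    (Q : Finset Γ) (ι : Type*) where
  /-- the position of the `i`-th cell of a point -/
  pos : ι → X → Γ
  isLocallyConstant_pos : ∀ i, IsLocallyConstant (pos i)
  pos_mem : ∀ i x, pos i x ∈ Q
  pos_smul_mem : ∀ i x, pos i x • x ∈ B
  eq_of_pos_eq : ∀ i j x y, pos i x = pos j y → i = j

variable {Γ X : Type*} [Group Γ] [TopologicalSpace X] [MulAction Γ X]

theorem exists_cellSystem [ContinuousConstSMul Γ X] [DecidableEq Γ] {E : Finset Γ} {B : Set X}
    (hB : IsClopen B) (hBE : IsSyndetic E B) {ι : Type*} [Fintype ι] {g : ι → Γ}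
    (hg : ∀ i j, ∀ e ∈ E, ∀ e' ∈ E, e * g i = e' * g j → i = j) :
    Nonempty (CellSystem B (E * Finset.univ.image g) ι) := by
  obtain ⟨t, ht, htB⟩ := exists_isLocallyConstant_choice (ι := E) (p := fun x e => (e : Γ) • x ∈ B)
    (fun e => isLocallyConstant_const_smul (isLocallyConstant_mem_iff.2 hB) (e : Γ))
    fun x => by simpa using hBE x
  exact ⟨{
    pos := fun i x => t (g i • x) * g i
    isLocallyConstant_pos := fun i =>
      (isLocallyConstant_const_smul ht (g i)).comp fun e => (e : Γ) * g i
    pos_mem := fun i x => Finset.mul_mem_mul (t _).2 (Finset.mem_image_of_mem g (Finset.mem_univ i))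
    pos_smul_mem := fun i x => by simpa only [mul_smul] using htB (g i • x)
    eq_of_pos_eq := fun i j x y h => hg i j _ (t _).2 _ (t _).2 h }⟩

namespace CellSystem

variable {B : Set X} {Q : Finset Γ} {ι : Type*} (K : CellSystem B Q ι)

/-- The set of cells painted by the markers in `B'`, where the marker `y` paints its cells with
index in `φ y`. -/
def paint (B' : Set X) (φ : X → Set ι) : Set X :=
  {u | ∃ y ∈ B', ∃ j ∈ φ y, K.pos j y • y = u}

/-- The values at the cells of `x` and at their translates by `c` do not reveal that `c` is not a
period at `x`, if `x` paints its cells with index in `v` and `η • x` paints its cells with index in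
`w`, while the other values are those of `b`. Cells and translates in `B'` are ignored. -/
def LooksPeriodic (B' b : Set X) (c : Γ) (x : X) (η : Γ) (v w : Set ι) : Prop :=
  ∀ i, K.pos i x • x ∉ B' → (K.pos i x * c) • x ∉ B' →
    (i ∈ v ↔ (K.pos i x * c) • x ∈ b \ B ∨ ∃ j ∈ w, K.pos j (η • x) * η = K.pos i x * c)

theorem paint_subset (B' : Set X) (φ : X → Set ι) : K.paint B' φ ⊆ B := by
  rintro _ ⟨y, -, j, -, rfl⟩
  exact K.pos_smul_mem j y

theorem isClopen_paint [ContinuousConstSMul Γ X] [Finite ι] {B' : Set X} (hB' : IsClopen B')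
    {φ : X → Set ι} (hφ : IsLocallyConstant φ) : IsClopen (K.paint B' φ) := by
  have hpaint : K.paint B' φ = {u | ∃ q : Q, ∃ j,
      (q : Γ)⁻¹ • u ∈ B' ∧ K.pos j ((q : Γ)⁻¹ • u) = q ∧ j ∈ φ ((q : Γ)⁻¹ • u)} := by
    ext u
    constructor
    · rintro ⟨y, hy, j, hj, rfl⟩
      exact ⟨⟨_, K.pos_mem j y⟩, j, by simpa using ⟨hy, hj⟩⟩
    · rintro ⟨q, j, hB, hq, hj⟩
      exact ⟨_, hB, j, hj, by rw [hq, smul_inv_smul]⟩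
  rw [hpaint, ← isLocallyConstant_mem_iff]
  refine isLocallyConstant_exists fun q => isLocallyConstant_exists fun j => ?_
  exact isLocallyConstant_const_smul (((isLocallyConstant_mem_iff.2 hB').prodMk
    ((K.isLocallyConstant_pos j).prodMk hφ)).comp fun s => s.1 ∧ s.2.1 = q ∧ j ∈ s.2.2) (q : Γ)⁻¹

theorem smul_mem_paint_iff {B' : Set X} {φ : X → Set ι} {x : X} {η p : Γ} (hη : η • x ∈ B')
    (huniq : ∀ q ∈ Q, (q⁻¹ * p) • x ∈ B' → q⁻¹ * p = η) :
    p • x ∈ K.paint B' φ ↔ ∃ j ∈ φ (η • x), K.pos j (η • x) * η = p := by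
  constructor
  · rintro ⟨y, hy, j, hj, hp⟩
    have hyx : y = ((K.pos j y)⁻¹ * p) • x := by rw [mul_smul, ← hp, inv_smul_smul]
    have hpos := huniq _ (K.pos_mem j y) (hyx ▸ hy)
    rw [hpos] at hyx
    rw [← hyx]
    exact ⟨j, hj, by rw [← hpos, mul_inv_cancel_left]⟩
  · rintro ⟨j, hj, rfl⟩
    exact ⟨η • x, hη, j, hj, (mul_smul _ _ _).symm⟩

theorem isLocallyConstant_looksPeriodic [ContinuousConstSMul Γ X] [Finite ι] (hB : IsClopen B)
    {B' b : Set X} (hB' : IsClopen B') (hb : IsClopen b) (c η : Γ) (v w : Set ι) :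
    IsLocallyConstant fun x => K.LooksPeriodic B' b c x η v w := by
  refine isLocallyConstant_forall fun i => ?_
  have hpos := K.isLocallyConstant_pos i
  have hposc : IsLocallyConstant fun x => K.pos i x * c := hpos.comp (· * c)
  have hcell := isLocallyConstant_smul hpos (isLocallyConstant_mem_iff.2 hB')
  have htrans := isLocallyConstant_smul hposc (isLocallyConstant_mem_iff.2 hB')
  have hvalue := isLocallyConstant_smul hposc (isLocallyConstant_mem_iff.2 (hb.diff hB))
  have hpaint : IsLocallyConstant fun x => ∃ j, j ∈ w ∧ K.pos j (η • x) * η = K.pos i x * c :=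
    isLocallyConstant_exists fun j =>
      ((isLocallyConstant_const_smul (K.isLocallyConstant_pos j) η).prodMk hposc).comp
        fun s => j ∈ w ∧ s.1 * η = s.2
  exact (hcell.prodMk (htrans.prodMk (hvalue.prodMk hpaint))).comp
    fun s => ¬ s.1 → ¬ s.2.1 → (i ∈ v ↔ s.2.2.1 ∨ s.2.2.2)

/-- The indices of the cells of `x` that lie outside `B'` together with their translates by `c`. -/
def unmarked (B' : Set X) (c : Γ) (x : X) : Set ι :=
  {i | K.pos i x • x ∉ B' ∧ (K.pos i x * c) • x ∉ B'}

variable [DecidableEq Γ] [Finite ι]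

theorem ncard_compl_unmarked_le {B' : Set X} (hB' : IsSeparatedBy (markerWindow Q) B') (c : Γ)
    (x : X) : (K.unmarked B' c x)ᶜ.ncard ≤ 2 := by
  have marked_le_one : ∀ c, {i | (K.pos i x * c) • x ∈ B'}.ncard ≤ 1 := by
    intro c
    refine Set.ncard_le_one_iff_subsingleton.2 fun i hi j hj => ?_
    have h := hB' _ hi (K.pos j x * (K.pos i x)⁻¹) (mul_mem_markerWindow
      (Finset.mem_union_left _ (K.pos_mem j x))
      (Finset.mem_union_right _ (Finset.inv_mem_inv (K.pos_mem i x))))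
      (by rw [smul_smul]; simpa [mul_assoc] using hj)
    exact (K.eq_of_pos_eq j i x x (mul_inv_eq_one.1 h)).symm
  have hcompl : (K.unmarked B' c x)ᶜ =
      {i | (K.pos i x * 1) • x ∈ B'} ∪ {i | (K.pos i x * c) • x ∈ B'} := by
    ext i
    simp only [unmarked, Set.mem_compl_iff, Set.mem_ofPred_eq, Set.mem_union, mul_one]
    tauto
  rw [hcompl]
  exact (Set.ncard_union_le _ _).trans (add_le_add (marked_le_one 1) (marked_le_one c))

theorem ncard_looksPeriodic_le {B' : Set X} (hB' : IsSeparatedBy (markerWindow Q) B') (b : Set X)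
    (c : Γ) (x : X) (η : Γ) (w : Set ι) : {v | K.LooksPeriodic B' b c x η v w}.ncard ≤ 4 := by
  refine (ncard_le_two_pow WellOrderingRel (H := (K.unmarked B' c x)ᶜ) fun i hi => ?_).trans
    (Nat.pow_le_pow_right two_pos (K.ncard_compl_unmarked_le hB' c x))
  have hi := Set.notMem_compl_iff.1 hi
  exact Or.inl ⟨_, fun v hv => hv i hi.1 hi.2⟩

theorem ncard_looksPeriodic_self_sq_le {B' : Set X} (hB' : IsSeparatedBy (markerWindow Q) B')
    (b : Set X) {c : Γ} (hc : c ≠ 1) (x : X) :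
    {v | K.LooksPeriodic B' b c x 1 v v}.ncard ^ 2 ≤ 2 ^ (Nat.card ι + 2) := by
  refine (ncard_sq_le_two_pow_of_linked (G := K.unmarked B' c x) fun i hi => ?_).trans
    (Nat.pow_le_pow_right two_pos (Nat.add_le_add_left (K.ncard_compl_unmarked_le hB' c x) _))
  have hv_iff : ∀ v ∈ {v | K.LooksPeriodic B' b c x 1 v v}, i ∈ v ↔
      (K.pos i x * c) • x ∈ b \ B ∨ ∃ j ∈ v, K.pos j x = K.pos i x * c := by
    intro v hv
    simpa only [one_smul, mul_one] using hv i hi.1 hi.2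
  by_cases hj : ∃ j, K.pos j x = K.pos i x * c
  · obtain ⟨j, hj⟩ := hj
    have hb : (K.pos i x * c) • x ∉ b \ B := fun h => h.2 (hj ▸ K.pos_smul_mem j x)
    refine Or.inr ⟨j, ?_, fun v hv => ?_⟩
    · rintro rfl
      exact hc (by simpa using hj)
    · rw [hv_iff v hv, or_iff_right hb]
      exact ⟨fun ⟨j', hj'v, hj'⟩ => K.eq_of_pos_eq j' j x x (hj'.trans hj.symm) ▸ hj'v,
        fun hjv => ⟨j, hjv, hj⟩⟩
  · refine Or.inl ⟨(K.pos i x * c) • x ∈ b \ B, fun v hv => ?_⟩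
    rw [hv_iff v hv, or_iff_left fun ⟨j, _, h⟩ => hj ⟨j, h⟩]

end CellSystem

variable [DecidableEq Γ] {B B' : Set X} {Q C : Finset Γ} {x : X} {c : Γ}

theorem CellSystem.exists_looksPeriodic {ι : Type*} (K : CellSystem B Q ι)
    (hB' : IsSeparatedBy (markerWindow Q) B') {b b₂ : Set X} {φ : X → Set ι}
    (hb₂ : b₂ \ B' = (b \ B ∪ K.paint B' φ) \ B') (hx : x ∈ B') (hc : c ∈ C)
    (hper : ∀ q ∈ Q, q • x ∈ b₂ ↔ (q * c) • x ∈ b₂) :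
    ∃ η ∈ partnerWindow Q C, η • x ∈ B' ∧ K.LooksPeriodic B' b c x η (φ x) (φ (η • x)) := by
  obtain ⟨η, hηN, hηB', hη⟩ := exists_partner hB' hx hc
  refine ⟨η, hηN, hηB', fun i hi hic => ?_⟩
  have mem_b₂ : ∀ y ∉ B', y ∈ b₂ ↔ y ∈ b \ B ∨ y ∈ K.paint B' φ := fun y hy => by
    simpa [hy] using Set.ext_iff.1 hb₂ y
  have cell_value : K.pos i x • x ∈ b₂ ↔ i ∈ φ x := by
    rw [mem_b₂ _ hi, or_iff_right fun h => h.2 (K.pos_smul_mem i x),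
      K.smul_mem_paint_iff (η := 1) (by rwa [one_smul])]
    · simp only [one_smul, mul_one]
      exact ⟨fun ⟨j, hj, h⟩ => K.eq_of_pos_eq j i x x h ▸ hj, fun h => ⟨i, h, rfl⟩⟩
    · exact fun q hq => hB' x hx _ (mul_mem_markerWindow
        (Finset.mem_union_right _ (Finset.inv_mem_inv hq))
        (Finset.mem_union_left _ (K.pos_mem i x)))
  rw [← cell_value, hper _ (K.pos_mem i x), mem_b₂ _ hic,
    K.smul_mem_paint_iff hηB' fun q hq => hη q hq _ (K.pos_mem i x)]

end Cells

section Breaking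

theorem assignment_card_bound {C N l : ℕ} (hC : 0 < C) (hN : 0 < N) (h : 11 * (C * N) < 2 ^ l) :
    C * 2 ^ (l + 1) + N * (C * 4 * 2 ^ (2 * l) / (2 ^ l + 1) + C * 4 + 2 ^ l) < 2 ^ (2 * l) := by
  have hdiv : C * 4 * 2 ^ (2 * l) / (2 ^ l + 1) ≤ C * 4 * 2 ^ l := by
    refine Nat.div_le_of_le_mul ?_
    calc C * 4 * 2 ^ (2 * l) = C * 4 * 2 ^ l * 2 ^ l := by ring
      _ ≤ C * 4 * 2 ^ l * (2 ^ l + 1) := by gcongr; exact Nat.le_succ _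
      _ = _ := mul_comm _ _
  calc C * 2 ^ (l + 1) + N * (C * 4 * 2 ^ (2 * l) / (2 ^ l + 1) + C * 4 + 2 ^ l)
      ≤ C * N * 2 ^ (l + 1) + N * (C * 4 * 2 ^ l + C * 4 * 2 ^ l + C * 2 ^ l) := by
        have h2l : C * 4 ≤ C * 4 * 2 ^ l := Nat.le_mul_of_pos_right _ (by positivity)
        have hCl : 2 ^ l ≤ C * 2 ^ l := Nat.le_mul_of_pos_left _ hC
        have hCN : C ≤ C * N := Nat.le_mul_of_pos_right C hN
        gcongr
    _ = 11 * (C * N) * 2 ^ l := by ring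
    _ < 2 ^ l * 2 ^ l := by gcongr
    _ = 2 ^ (2 * l) := by ring

variable {Γ : Type u} [Group Γ]

theorem CellSystem.exists_assignment [DecidableEq Γ] {X : Type*} [TopologicalSpace X]
    [LindelofSpace X] [T2Space X] [MulAction Γ X] [ContinuousConstSMul Γ X] (hX : ZeroDimensional X)
    (hfree : FreeAction Γ X) {B B' b : Set X} (hB : IsClopen B) (hB' : IsClopen B')
    (hb : IsClopen b) {Q C : Finset Γ} {l : ℕ} (K : CellSystem B Q (Fin (2 * l)))
    (hsep : IsSeparatedBy (markerWindow Q) B') (hCne : C.Nonempty) (hC : ∀ c ∈ C, c ≠ 1)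
    (hcard : 11 * (C.card * (partnerWindow Q C).card) < 2 ^ l) :
    ∃ φ : X → Set (Fin (2 * l)), IsLocallyConstant φ ∧ ∀ x ∈ B', ∀ η ∈ partnerWindow Q C,
      η • x ∈ B' → ∀ c ∈ C, ¬ K.LooksPeriodic B' b c x η (φ x) (φ (η • x)) := by
  obtain ⟨ρ, hρ, hρN⟩ := exists_rank hX hfree (partnerWindow Q C)
  have hfail : ∀ η v w,
      IsLocallyConstant fun x => ∃ c : C, K.LooksPeriodic B' b c x η v w := fun η v w =>
    isLocallyConstant_exists fun c => K.isLocallyConstant_looksPeriodic hB hB' hb c η v w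
  have hself : ∀ x ∈ B', {v | ∃ c : C, K.LooksPeriodic B' b c x 1 v v}.ncard ≤
      C.card * 2 ^ (l + 1) := by
    intro x _
    simp only [Subtype.exists, exists_prop]
    refine ncard_setOf_exists_mem_le C fun c hc => ?_
    refine (Nat.pow_le_pow_iff_left two_ne_zero).1 ?_
    refine (K.ncard_looksPeriodic_self_sq_le hsep b (hC c hc) x).trans_eq ?_
    rw [Nat.card_eq_fintype_card, Fintype.card_fin]
    ring
  have hpair : ∀ x ∈ B', ∀ η w, {v | ∃ c : C, K.LooksPeriodic B' b c x η v w}.ncard ≤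
      C.card * 4 := by
    intro x _ η w
    simp only [Subtype.exists, exists_prop]
    exact ncard_setOf_exists_mem_le C fun c _ => K.ncard_looksPeriodic_le hsep b c x η w
  have hvalues : Nat.card (Set (Fin (2 * l))) = 2 ^ (2 * l) := by
    rw [Nat.card_eq_fintype_card, Fintype.card_set, Fintype.card_fin]
  obtain ⟨φ, hφ, hφx⟩ := ContinuousColoring.exists_assignment (fun η => inv_mem_partnerWindow)
    hρ hρN (m := 2 ^ l) hfail hself hpair (by
      rw [hvalues]
      exact assignment_card_bound hCne.card_pos
        (Finset.card_pos.2 ⟨1, Finset.mem_insert_self _ _⟩) hcard)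
  exact ⟨φ, hφ, fun x hx η hη hηx c hc hper => hφx x hx η hη hηx ⟨⟨c, hc⟩, hper⟩⟩

/-- No point of the space has `γ` as a period of the indicator function of `b`, and this is
witnessed by a translate by an element of `T`. -/
def BreaksPeriod {Γ X : Type*} [Group Γ] [MulAction Γ X] (γ : Γ) (T : Finset Γ)
    (b : Set X) : Prop :=
  ∀ x : X, ∃ t ∈ T, ¬ (t • x ∈ b ↔ (t * γ) • x ∈ b)

theorem CellSystem.breaksPeriod [DecidableEq Γ] {X : Type*} [MulAction Γ X] [TopologicalSpace X]
    {B B' b : Set X} {E Q : Finset Γ} {ι : Type*} (K : CellSystem B Q ι)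
    (hsep : IsSeparatedBy (markerWindow Q) B') (hsynd : IsSyndetic (markerWindow Q * E) B') {γ : Γ}
    {φ : X → Set ι} (hφ : ∀ x ∈ B', ∀ η ∈ partnerWindow Q (conjugateWindow E Q γ), η • x ∈ B' →
      ∀ c ∈ conjugateWindow E Q γ, ¬ K.LooksPeriodic B' b c x η (φ x) (φ (η • x)))
    {b₂ : Set X} (hb₂ : b₂ \ B' = (b \ B ∪ K.paint B' φ) \ B') :
    BreaksPeriod γ (Q * (markerWindow Q * E)) b₂ := by
  intro y
  by_contra! hper
  obtain ⟨s, hs, hsy⟩ := hsynd y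
  have hc : s * γ * s⁻¹ ∈ conjugateWindow E Q γ := Finset.mem_image_of_mem _ hs
  obtain ⟨η, hη, hηB', hlooks⟩ := K.exists_looksPeriodic hsep hb₂ hsy hc fun q hq => by
    simpa only [smul_smul, mul_assoc, inv_mul_cancel, mul_one]
      using hper (q * s) (Finset.mul_mem_mul hq hs)
  exact hφ _ hsy η hη hηB' _ hc hlooks

theorem exists_markers {X : Type*} [DecidableEq Γ] [TopologicalSpace X] [LindelofSpace X]
    [T2Space X] [MulAction Γ X] [ContinuousConstSMul Γ X] (hX : ZeroDimensional X)
    (hfree : FreeAction Γ X) {E Q : Finset Γ} (hQ : Q.Nonempty) {B : Set X} (hB : IsClopen B)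
    (hBE : IsSyndetic E B) :
    ∃ B' ⊆ B, IsClopen B' ∧ IsSeparatedBy (markerWindow Q) B' ∧
      IsSyndetic (markerWindow Q * E) B' := by
  obtain ⟨B', hB'B, hB', hsep, hmax⟩ := exists_maximal_isSeparatedBy hX hfree
    (one_mem_markerWindow hQ) (fun _ => inv_mem_pow_union_inv 4) hB
  refine ⟨B', hB'B, hB', hsep, fun x => ?_⟩
  obtain ⟨e, he, hex⟩ := hBE x
  obtain ⟨α, hα, hαx⟩ := hmax _ hex
  exact ⟨α * e, Finset.mul_mem_mul hα he, by rwa [mul_smul]⟩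

theorem exists_breaking_step [Infinite Γ] {E : Finset Γ} (hE : E.Nonempty) {γ : Γ} (hγ : γ ≠ 1) :
    ∃ E' T : Finset Γ, E'.Nonempty ∧ ∀ (X : Type v) [TopologicalSpace X] [LindelofSpace X]
      [T2Space X] [MulAction Γ X] [ContinuousConstSMul Γ X], ZeroDimensional X → FreeAction Γ X →
      ∀ B : Set X, IsClopen B → IsSyndetic E B → ∀ b : Set X, IsClopen b →
        ∃ B' ⊆ B, IsClopen B' ∧ IsSyndetic E' B' ∧ ∃ b₁ : Set X, IsClopen b₁ ∧ b₁ \ B = b \ B ∧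
          ∀ b₂ : Set X, b₂ \ B' = b₁ \ B' → BreaksPeriod γ T b₂ := by
  classical
  obtain ⟨l, hl, hscale⟩ := exists_scale hE γ
  obtain ⟨g, hg⟩ := exists_seq_disjoint_translates E
  let Q := E * Finset.univ.image fun i : Fin (2 * l) => g i
  have hQ : Q.Nonempty :=
    hE.mul ⟨g 0, Finset.mem_image_of_mem _ (Finset.mem_univ (⟨0, by omega⟩ : Fin (2 * l)))⟩
  have hQcard : Q.card ≤ E.card * (2 * l) := Finset.card_mul_le.trans
    (Nat.mul_le_mul_left _ (Finset.card_image_le.trans (by rw [Finset.card_fin])))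
  have hE' : (markerWindow Q * E).Nonempty := Finset.Nonempty.mul ⟨1, one_mem_markerWindow hQ⟩ hE
  refine ⟨markerWindow Q * E, Q * (markerWindow Q * E), hE', ?_⟩
  intro X _ _ _ _ _ hX hfree B hB hBE b hb
  obtain ⟨B', hB'B, hB', hsep, hsynd⟩ := exists_markers hX hfree hQ hB hBE
  obtain ⟨K⟩ := exists_cellSystem (g := fun i : Fin (2 * l) => g i) hB hBE
    fun i j e he e' he' h => Fin.ext (hg i j e he e' he' h)
  have hC : ∀ c ∈ conjugateWindow E Q γ, c ≠ 1 := fun c hc => by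
    obtain ⟨t, -, rfl⟩ := Finset.mem_image.1 hc
    exact mt conj_eq_one_iff.1 hγ
  obtain ⟨φ, hφ, hφx⟩ := K.exists_assignment hX hfree hB hB' hb hsep
    (hE'.image _) hC (hscale Q hQ hQcard)
  refine ⟨B', hB'B, hB', hsynd, b \ B ∪ K.paint B' φ,
    (hb.diff hB).union (K.isClopen_paint hB' hφ), ?_,
    fun b₂ hb₂ => K.breaksPeriod hsep hsynd hφx hb₂⟩
  rw [Set.union_sdiff_distrib, Set.sdiff_eq_empty.2 (K.paint_subset B' φ), Set.union_empty,
    Set.sdiff_sdiff, Set.union_self]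

theorem exists_breaking_sets [Infinite Γ] (γ : ℕ → Γ) (hγ : ∀ s, γ s ≠ 1) :
    ∃ T : ℕ → Finset Γ, ∀ (X : Type v) [TopologicalSpace X] [LindelofSpace X] [T2Space X]
      [MulAction Γ X] [ContinuousConstSMul Γ X], ZeroDimensional X → FreeAction Γ X →
      ∀ r, ∃ b : Set X, IsClopen b ∧ ∀ s < r, BreaksPeriod (γ s) (T s) b := by
  choose E' T hE' hstep using fun (E : {E : Finset Γ // E.Nonempty}) s =>
    exists_breaking_step.{u, v} E.2 (hγ s)
  let E : ℕ → {E : Finset Γ // E.Nonempty} := fun s =>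
    Nat.rec ⟨{1}, Finset.singleton_nonempty 1⟩ (fun s E => ⟨E' E s, hE' E s⟩) s
  refine ⟨fun s => T (E s) s, fun X _ _ _ _ _ hX hfree r => ?_⟩
  have robust : ∃ B : Set X, IsClopen B ∧ IsSyndetic (E r).1 B ∧ ∃ b : Set X, IsClopen b ∧
      ∀ b₂ : Set X, b₂ \ B = b \ B → ∀ s < r, BreaksPeriod (γ s) (T (E s) s) b₂ := by
    induction r with
    | zero =>
      exact ⟨Set.univ, isClopen_univ, fun x => ⟨1, Finset.mem_singleton_self 1, trivial⟩,
        ∅, isClopen_empty, fun _ _ s hs => absurd hs s.not_lt_zero⟩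
    | succ r ih =>
      obtain ⟨B, hB, hBE, b, hb, hbreak⟩ := ih
      obtain ⟨B', hB'B, hB', hBE', b₁, hb₁, hb₁b, hstep⟩ :=
        hstep (E r) r X hX hfree B hB hBE b hb
      refine ⟨B', hB', hBE', b₁, hb₁, fun b₂ hb₂ s hs => ?_⟩
      rcases Nat.lt_succ_iff_lt_or_eq.1 hs with hs | rfl
      · have hsub : b₂ \ B = b₁ \ B := by
          have h := congrArg (· \ B) hb₂
          simpa only [Set.sdiff_sdiff, Set.union_eq_self_of_subset_left hB'B] using h
        exact hbreak b₂ (hsub.trans hb₁b) s hs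
      · exact hstep b₂ hb₂
  obtain ⟨B, -, -, b, hb, hbreak⟩ := robust
  exact ⟨b, hb, hbreak b rfl⟩

end Breaking

section Shift

variable {Γ : Type u}

instance Shift.instCompactSpace (k : ℕ) : CompactSpace (Shift Γ k) :=
  inferInstanceAs (CompactSpace (Γ → Fin k))

instance Shift.instT2Space (k : ℕ) : T2Space (Shift Γ k) :=
  inferInstanceAs (T2Space (Γ → Fin k))

instance Shift.instTotallyDisconnectedSpace (k : ℕ) : TotallyDisconnectedSpace (Shift Γ k) :=
  inferInstanceAs (TotallyDisconnectedSpace (Γ → Fin k))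

instance Shift.instSecondCountableTopology [Countable Γ] (k : ℕ) :
    SecondCountableTopology (Shift Γ k) :=
  inferInstanceAs (SecondCountableTopology (Γ → Fin k))

theorem Shift.continuous_apply {k : ℕ} (δ : Γ) : Continuous fun x : Shift Γ k => x δ :=
  _root_.continuous_apply (A := fun _ : Γ => Fin k) δ

theorem Shift.continuous_of_apply {k : ℕ} {X : Type*} [TopologicalSpace X] {f : X → Shift Γ k}
    (h : ∀ δ, Continuous fun x => f x δ) : Continuous f :=
  continuous_pi (A := fun _ : Γ => Fin k) h

variable [Group Γ]

theorem Shift.smul_apply {k : ℕ} (γ δ : Γ) (x : Shift Γ k) : (γ • x) δ = x (δ * γ) := rfl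

instance Shift.instContinuousConstSMul (k : ℕ) : ContinuousConstSMul Γ (Shift Γ k) :=
  ⟨fun γ => Shift.continuous_of_apply fun δ => Shift.continuous_apply (δ * γ)⟩

variable {X : Type v} [MulAction Γ X]

open Classical in
/-- The sequence of visits of the orbit of `x` to the set `b`. -/
noncomputable def itinerary (b : Set X) (x : X) : Shift Γ 2 :=
  fun δ => if δ • x ∈ b then 1 else 0

theorem itinerary_smul (b : Set X) (γ : Γ) (x : X) :
    itinerary b (γ • x) = γ • (itinerary b x : Shift Γ 2) := by
  funext δ
  rw [Shift.smul_apply, itinerary, itinerary, mul_smul]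

theorem itinerary_eq_iff {b : Set X} {x : X} {δ δ' : Γ} :
    (itinerary b x : Shift Γ 2) δ = itinerary b x δ' ↔ (δ • x ∈ b ↔ δ' • x ∈ b) := by
  by_cases h : δ • x ∈ b <;> by_cases h' : δ' • x ∈ b <;> simp [itinerary, h, h']

theorem continuous_itinerary [TopologicalSpace X] [ContinuousConstSMul Γ X] {b : Set X}
    (hb : IsClopen b) : Continuous (itinerary b : X → Shift Γ 2) := by
  classical
  refine Shift.continuous_of_apply fun δ => ?_
  exact ((isLocallyConstant_const_smul (isLocallyConstant_mem_iff.2 hb) δ).comp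
    fun p => if p then (1 : Fin 2) else 0).continuous

end Shift

section Compactness

variable {Γ : Type u} [Group Γ] {k : ℕ} {P : Set (Pattern Γ k)}

theorem HasContinuousAvoidingColoring.comap {X Y : Type*} [TopologicalSpace X] [TopologicalSpace Y]
    [MulAction Γ X] [MulAction Γ Y] (h : HasContinuousAvoidingColoring P Y) {π : X → Y}
    (hπ : Continuous π) (hπsmul : ∀ (γ : Γ) x, π (γ • x) = γ • π x) :
    HasContinuousAvoidingColoring P X := by
  obtain ⟨f, hf, hfP⟩ := h
  exact ⟨f ∘ π, hf.comp hπ, fun p hp ⟨x, hx⟩ =>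
    hfP p hp ⟨π x, fun γ => (congrArg f (hπsmul γ x)).symm.trans (hx γ)⟩⟩

variable {Y : Type*} [TopologicalSpace Y]

theorem exists_continuous_extension [CompactSpace Y] [T2Space Y] [TotallyDisconnectedSpace Y]
    {K : Set Y} (hK : IsClosed K) {α : Type*} [TopologicalSpace α] [DiscreteTopology α] [Finite α]
    [Nonempty α] {f : K → α} (hf : Continuous f) :
    ∃ F : Y → α, Continuous F ∧ ∀ y : K, F y = f y := by
  have : CompactSpace K := isCompact_iff_compactSpace.1 hK.isCompact
  obtain ⟨F, hF, -, hFf⟩ := Profinite.exists_lift_of_finite_of_injective_of_surjective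
    (T := Unit) (Subtype.val : K → Y) continuous_subtype_val Subtype.val_injective
    (fun _ : α => ()) (fun _ => ⟨Classical.arbitrary _, rfl⟩) f hf
    (fun _ => ()) continuous_const rfl
  exact ⟨F, hF, fun y => congrFun hFf y⟩

variable [MulAction Γ Y] [ContinuousConstSMul Γ Y]

theorem isClosed_setOf_occurs_at {f : Y → Fin k} (hf : Continuous f) (p : Pattern Γ k) :
    IsClosed {y | ∀ γ : p.dom, f ((γ : Γ) • y) = p.val γ} := by
  simp only [Set.ofPred_forall]
  exact isClosed_iInter fun γ =>
    (isClosed_discrete {p.val γ}).preimage (hf.comp (continuous_const_smul (γ : Γ)))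

theorem HasContinuousAvoidingColoring.exists_of_directed [CompactSpace Y] [T2Space Y]
    [TotallyDisconnectedSpace Y] [NeZero k] (hP : P.Finite) {K : SubMulAction Γ Y}
    (h : HasContinuousAvoidingColoring P K) {ι : Type*} [Nonempty ι] {Z : ι → SubMulAction Γ Y}
    (hZ : ∀ i, IsClosed (Z i : Set Y)) (hdir : Directed (· ≥ ·) Z)
    (hZK : ⋂ i, (Z i : Set Y) ⊆ K) : ∃ i, HasContinuousAvoidingColoring P (Z i) := by
  obtain ⟨f, hf, hfP⟩ := h
  obtain ⟨F, hF, hFf⟩ := exists_continuous_extension (isClosed_iInter hZ)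
    (hf.comp (continuous_inclusion hZK))
  have hbad : IsClosed (⋃ p ∈ P, {y | ∀ γ : p.dom, F ((γ : Γ) • y) = p.val γ}) :=
    hP.isClosed_biUnion fun p _ => isClosed_setOf_occurs_at hF p
  have hdisj : (⋃ p ∈ P, {y | ∀ γ : p.dom, F ((γ : Γ) • y) = p.val γ}) ∩
      ⋂ i, (Z i : Set Y) = ∅ := by
    refine Set.eq_empty_iff_forall_notMem.2 fun y ⟨hbad, hy⟩ => ?_
    obtain ⟨p, hp, hpy⟩ := Set.mem_iUnion₂.1 hbad
    refine hfP p hp ⟨⟨y, hZK hy⟩, fun γ => ?_⟩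
    have hγy : (γ : Γ) • y ∈ ⋂ i, (Z i : Set Y) :=
      Set.mem_iInter.2 fun i => (Z i).smul_mem _ (Set.mem_iInter.1 hy i)
    exact (hFf ⟨_, hγy⟩).symm.trans (hpy γ)
  obtain ⟨i, hi⟩ := hbad.isCompact.elim_directed_family_closed (fun i => (Z i : Set Y)) hZ hdisj
    hdir
  refine ⟨i, fun y => F y, hF.comp continuous_subtype_val, fun p hp ⟨y, hy⟩ => ?_⟩
  exact Set.eq_empty_iff_forall_notMem.1 hi y ⟨Set.mem_biUnion hp hy, y.2⟩

/-- The closed set of those points of `2^Γ` for which `T s` witnesses, at each of their translates,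
that `γ s` is not a period, for all `s < r`. -/
def breakingSubshift (γ : ℕ → Γ) (T : ℕ → Finset Γ) (r : ℕ) : SubMulAction Γ (Shift Γ 2) where
  carrier := {z | ∀ s < r, ∀ δ, ∃ t ∈ T s, z (t * δ) ≠ z (t * γ s * δ)}
  smul_mem' := fun γ' z hz s hs δ => by
    simpa only [Shift.smul_apply, mul_assoc] using hz s hs (δ * γ')

theorem isClosed_breakingSubshift (γ : ℕ → Γ) (T : ℕ → Finset Γ) (r : ℕ) :
    IsClosed (breakingSubshift γ T r : Set (Shift Γ 2)) := by
  have hset : (breakingSubshift γ T r : Set (Shift Γ 2)) =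
      ⋂ s < r, ⋂ δ, ⋃ t ∈ T s, {z | z (t * δ) ≠ z (t * γ s * δ)} := by
    ext z
    simp only [Set.mem_iInter, Set.mem_iUnion, exists_prop]
    rfl
  rw [hset]
  refine isClosed_iInter fun s => isClosed_iInter fun _ => isClosed_iInter fun δ =>
    (T s).finite_toSet.isClosed_biUnion fun t _ => ?_
  exact (isClosed_discrete {p : Fin 2 × Fin 2 | p.1 ≠ p.2}).preimage
    ((Shift.continuous_apply (t * δ)).prodMk (Shift.continuous_apply (t * γ s * δ)))

theorem iInter_breakingSubshift_subset {γ : ℕ → Γ} (hγ : ∀ g ≠ 1, ∃ s, γ s = g)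
    (T : ℕ → Finset Γ) :
    ⋂ r, (breakingSubshift γ T r : Set (Shift Γ 2)) ⊆ FreePart Γ (Shift Γ 2) := by
  intro z hz
  refine (Subgroup.eq_bot_iff_forall _).2 fun g hg => ?_
  by_contra hg1
  obtain ⟨s, rfl⟩ := hγ g hg1
  obtain ⟨t, -, ht⟩ := Set.mem_iInter.1 hz (s + 1) s s.lt_succ_self 1
  have hperiod : z (t * γ s) = z t := congrFun (hg : γ s • z = z) t
  exact ht (by rw [mul_one, mul_one, hperiod])

theorem itinerary_mem_breakingSubshift {X : Type*} [MulAction Γ X] {b : Set X} {γ : ℕ → Γ}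
    {T : ℕ → Finset Γ} {r : ℕ} (hb : ∀ s < r, BreaksPeriod (γ s) (T s) b) (x : X) :
    itinerary b x ∈ breakingSubshift γ T r := by
  intro s hs δ
  obtain ⟨t, ht, hne⟩ := hb s hs (δ • x)
  exact ⟨t, ht, fun heq => hne (by simpa only [itinerary_eq_iff, mul_smul] using heq)⟩

theorem hasContinuousAvoidingColoring_of_freePart [Countable Γ] [Infinite Γ] [NeZero k]
    (hP : P.Finite) (h : HasContinuousAvoidingColoring P (FreePart Γ (Shift Γ 2)))
    (X : Type v) [TopologicalSpace X] [LindelofSpace X] [T2Space X] [MulAction Γ X]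
    [ContinuousConstSMul Γ X] (hX : ZeroDimensional X) (hfree : FreeAction Γ X) :
    HasContinuousAvoidingColoring P X := by
  obtain ⟨γ₀, hγ₀⟩ := exists_ne (1 : Γ)
  have : Nonempty {γ : Γ // γ ≠ 1} := ⟨⟨γ₀, hγ₀⟩⟩
  obtain ⟨e, he⟩ := exists_surjective_nat {γ : Γ // γ ≠ 1}
  let γ : ℕ → Γ := fun s => e s
  have hγ : ∀ g ≠ 1, ∃ s, γ s = g := fun g hg => (he ⟨g, hg⟩).imp fun s => congrArg Subtype.val
  obtain ⟨T, hT⟩ := exists_breaking_sets.{u, v} γ fun s => (e s).2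
  have hanti : Antitone (breakingSubshift γ T) := fun r r' hr z hz s hs => hz s (hs.trans_le hr)
  obtain ⟨r, hr⟩ := h.exists_of_directed hP (isClosed_breakingSubshift γ T) hanti.directed_ge
    (iInter_breakingSubshift_subset hγ T)
  obtain ⟨b, hb, hbT⟩ := hT X hX hfree r
  exact hr.comap ((continuous_itinerary hb).subtype_mk (itinerary_mem_breakingSubshift hbT))
    fun g x => Subtype.ext (itinerary_smul b g x)

end Compactness

section FreePart

theorem ZeroDimensional.of_isInducing {X : Type u} {Y : Type v} [TopologicalSpace X]
    [TopologicalSpace Y] (hY : ZeroDimensional Y) {f : X → Y} (hf : IsInducing f) :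
    ZeroDimensional X := by
  refine TopologicalSpace.isTopologicalBasis_of_isOpen_of_nhds (fun U hU => hU.isOpen) ?_
  intro x U hx hU
  obtain ⟨_, ⟨V, hV, rfl⟩, hxV, hVU⟩ := (hY.isInducing hf).exists_subset_of_mem_open hx hU
  exact ⟨_, hV.preimage hf.continuous, hxV, hVU⟩

variable {Γ : Type u} [Group Γ]

instance FreePart.instSecondCountableTopology (X : Type v) [TopologicalSpace X]
    [SecondCountableTopology X] [MulAction Γ X] : SecondCountableTopology (FreePart Γ X) :=
  TopologicalSpace.Subtype.secondCountableTopology (FreePart Γ X : Set X)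

instance FreePart.instContinuousConstSMul (X : Type v) [TopologicalSpace X] [MulAction Γ X]
    [ContinuousConstSMul Γ X] : ContinuousConstSMul Γ (FreePart Γ X) :=
  ⟨fun γ => ((continuous_const_smul γ).comp continuous_subtype_val).subtype_mk _⟩

theorem zeroDimensional_freePart_shift (k : ℕ) : ZeroDimensional (FreePart Γ (Shift Γ k)) :=
  ZeroDimensional.of_isInducing isTopologicalBasis_isClopen IsInducing.subtypeVal

theorem freeAction_freePart (X : Type v) [MulAction Γ X] : FreeAction Γ (FreePart Γ X) := by
  intro x
  rw [SubMulAction.stabilizer_of_subMul]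
  exact x.2

end FreePart

section Tiles

variable {Γ : Type u} [Group Γ]

/-- The injection of `D` into `n` that records the colors of the translates `δ • x`, `δ ∈ D`. -/
def orbitTile {X : Type*} [MulAction Γ X] {D : Finset Γ} {n : ℕ} {c : X → Fin n}
    (hc : ∀ x, Function.Injective fun δ : D => c ((δ : Γ) • x)) (x : X) : D ↪ Fin n :=
  ⟨_, hc x⟩

theorem isLocallyConstant_orbitTile {X : Type*} [TopologicalSpace X] [MulAction Γ X]
    [ContinuousConstSMul Γ X] {D : Finset Γ} {n : ℕ} {c : X → Fin n} (hcont : IsLocallyConstant c)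
    (hc : ∀ x, Function.Injective fun δ : D => c ((δ : Γ) • x)) :
    IsLocallyConstant (orbitTile hc) := by
  have hcoe : IsLocallyConstant fun x => (orbitTile hc x : D → Fin n) :=
    isLocallyConstant_pi fun δ => isLocallyConstant_const_smul hcont (δ : Γ)
  refine (IsLocallyConstant.iff_eventually_eq _).2 fun x => ?_
  exact ((IsLocallyConstant.iff_eventually_eq _).1 hcoe x).mono fun y hy =>
    DFunLike.coe_injective hy

theorem exists_coloring_injective_translates {X : Type*} [TopologicalSpace X] [LindelofSpace X]
    [T2Space X] [MulAction Γ X] [ContinuousConstSMul Γ X] (hX : ZeroDimensional X)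
    (hfree : FreeAction Γ X) {D : Finset Γ} (hD : D.Nonempty) {V : Type*} [Fintype V]
    (hV : D.card ^ 2 ≤ Fintype.card V) :
    ∃ c : X → V, IsLocallyConstant c ∧ ∀ x, Function.Injective fun δ : D => c ((δ : Γ) • x) := by
  classical
  have hquot : ∀ δ ∈ D, ∀ δ' ∈ D, δ * δ'⁻¹ ∈ D * D⁻¹ := fun δ hδ δ' hδ' =>
    Finset.mul_mem_mul hδ (Finset.inv_mem_inv hδ')
  have hcard : ((D * D⁻¹).erase 1).card < Fintype.card V := by
    obtain ⟨δ, hδ⟩ := hD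
    have h1 : 1 ∈ D * D⁻¹ := by simpa using hquot δ hδ δ hδ
    refine (Finset.card_erase_lt_of_mem h1).trans_le (Finset.card_mul_le.trans ?_)
    rwa [Finset.card_inv, ← sq]
  obtain ⟨c, hc, hcD⟩ := exists_proper_coloring hX hfree (D * D⁻¹)
    (fun γ hγ => by simpa using Finset.inv_mem_inv hγ) hcard
  refine ⟨c, hc, fun x δ δ' heq => Subtype.ext ?_⟩
  by_contra hne
  refine hcD ((δ' : Γ) • x) (δ * (δ' : Γ)⁻¹) (hquot _ δ.2 _ δ'.2) (mt mul_inv_eq_one.1 hne) ?_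
  rw [smul_smul, inv_mul_cancel_right]
  exact heq

variable [DecidableEq Γ]

theorem isHom_orbitTile {X : Type*} [MulAction Γ X] {S D : Finset Γ} (hD : S ∪ S⁻¹ ∪ {1} ⊆ D)
    {n : ℕ} {c : X → Fin n} (hc : ∀ x, Function.Injective fun δ : D => c ((δ : Γ) • x)) (x : X) :
    (cayleyGraph S).IsHom (tileGraph S D n hD) fun γ => orbitTile hc (γ • x) := by
  rintro γ _ ⟨hne, σ, hσ, rfl⟩
  have hcomp : Compatible σ (orbitTile hc (γ • x)) (orbitTile hc ((σ * γ) • x)) := fun δ δ' hδ =>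
    congrArg c (by rw [hδ, mul_smul, mul_smul])
  refine ⟨⟨fun heq => hne ?_, σ, hσ, hcomp⟩, ?_⟩
  · have h1 : (1 : Γ) ∈ D := hD (by simp)
    have hσD : σ ∈ D := hD (Finset.mem_union_left _ hσ)
    have hcolor : c ((1 : Γ) • γ • x) = c (σ • γ • x) := by
      rw [one_smul, smul_smul]
      simpa only [orbitTile, Function.Embedding.coeFn_mk, one_smul]
        using DFunLike.congr_fun heq ⟨1, h1⟩
    have hσ1 : (⟨1, h1⟩ : D) = ⟨σ, hσD⟩ := hc (γ • x) hcolor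
    rw [← Subtype.mk.inj hσ1, one_mul]
  · exact (tileLabel_eq hD hσ hcomp).trans (mul_inv_cancel_right σ γ).symm

theorem hasContinuousAvoidingColoring_of_tileGraph {k : ℕ} {P : Set (Pattern Γ k)}
    {S D : Finset Γ} {n : ℕ} (hD : S ∪ S⁻¹ ∪ {1} ⊆ D) (hn : D.card ^ 2 ≤ n)
    (h : (tileGraph S D n hD).HasAvoidingColoring P) (X : Type v) [TopologicalSpace X]
    [LindelofSpace X] [T2Space X] [MulAction Γ X] [ContinuousConstSMul Γ X]
    (hX : ZeroDimensional X) (hfree : FreeAction Γ X) : HasContinuousAvoidingColoring P X := by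
  obtain ⟨f, hf⟩ := h
  have hDne : D.Nonempty := ⟨1, hD (by simp)⟩
  obtain ⟨c, hc, hinj⟩ := exists_coloring_injective_translates hX hfree hDne (V := Fin n)
    (by rwa [Fintype.card_fin])
  exact ⟨f ∘ orbitTile hinj, ((isLocallyConstant_orbitTile hc hinj).comp f).continuous,
    fun p hp ⟨x, hx⟩ => hf p hp
      ⟨fun γ => orbitTile hinj ((γ : Γ) • x), fun γ γ' => isHom_orbitTile hD hinj x γ γ', hx⟩⟩

end Tiles

section LogStar

/-- Iterated powers of two. -/
def tower : ℕ → ℕ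
  | 0 => 1
  | t + 1 => 2 ^ tower t

theorem lt_tower (t : ℕ) : t < tower t := by
  induction t with
  | zero => exact Nat.one_pos
  | succ t ih => exact (Nat.succ_le_of_lt ih).trans_lt Nat.lt_two_pow_self

theorem iterate_logb_le_tower_iff {t : ℕ} (m : ℕ) {x : ℝ} (hx : ∀ s < t, 1 < (Real.logb 2)^[s] x) :
    (Real.logb 2)^[t] x ≤ tower m ↔ x ≤ tower (t + m) := by
  induction t generalizing x with
  | zero => rw [Function.iterate_zero_apply, Nat.zero_add]
  | succ t ih =>
    have hx0 : 0 < x := zero_lt_one.trans (hx 0 t.succ_pos)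
    rw [Function.iterate_succ_apply, ih fun s hs => by
      simpa only [Function.iterate_succ_apply] using hx (s + 1) (Nat.succ_lt_succ hs),
      Real.logb_le_iff_le_rpow one_lt_two hx0, Real.rpow_natCast, Nat.add_right_comm]
    simp only [tower, Nat.cast_pow, Nat.cast_ofNat]

theorem logStar_le_iff {n t : ℕ} : logStar n ≤ t ↔ n ≤ tower t := by
  have exists_le_one : ∀ t, n ≤ tower t → ∃ s ≤ t, (Real.logb 2)^[s] (n : ℝ) ≤ 1 := by
    intro t hn
    by_contra! h
    refine (h t le_rfl).not_ge ?_
    simpa [tower, hn] using iterate_logb_le_tower_iff 0 (fun s hs => h s hs.le)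
  constructor
  · intro ht
    obtain ⟨s, -, hs⟩ := exists_le_one n (lt_tower n).le
    have hmem : logStar n ∈ {t : ℕ | (Real.logb 2)^[t] (n : ℝ) ≤ 1} := Nat.sInf_mem ⟨s, hs⟩
    have hle : (Real.logb 2)^[logStar n] (n : ℝ) ≤ tower (t - logStar n) :=
      le_trans hmem (by exact_mod_cast (Nat.zero_le _).trans_lt (lt_tower (t - logStar n)))
    have hlt : ∀ s < logStar n, 1 < (Real.logb 2)^[s] (n : ℝ) := fun s hs =>
      not_le.1 (Nat.notMem_of_lt_sInf hs)
    have hn := (iterate_logb_le_tower_iff (t - logStar n) hlt).1 hle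
    rw [Nat.add_sub_cancel' ht] at hn
    exact_mod_cast hn
  · intro hn
    obtain ⟨s, hst, hs⟩ := exists_le_one t hn
    exact (Nat.sInf_le hs).trans hst

theorem le_tower_logStar (n : ℕ) : n ≤ tower (logStar n) :=
  logStar_le_iff.1 le_rfl

theorem logStar_ne_zero {n : ℕ} (hn : 2 ≤ n) : logStar n ≠ 0 := by
  rw [← Nat.pos_iff_ne_zero, ← not_le, logStar_le_iff, not_le]
  exact hn

theorem exists_pow_logStar_le (c : ℕ) : ∃ n, 2 ≤ n ∧ c ^ (2 * logStar n) ≤ n := by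
  obtain ⟨l, hl, h⟩ := exists_pow_mul_lt_two_pow (6 * c) 1
  refine ⟨tower (l + 2), by have := lt_tower (l + 2); omega, ?_⟩
  have hexp : c * (2 * (l + 2)) ≤ 6 * c * l ^ 1 := by
    nlinarith [Nat.mul_le_mul_left c hl]
  calc c ^ (2 * logStar (tower (l + 2))) ≤ (2 ^ c) ^ (2 * logStar (tower (l + 2))) :=
        Nat.pow_le_pow_left Nat.lt_two_pow_self.le _
    _ ≤ (2 ^ c) ^ (2 * (l + 2)) :=
        Nat.pow_le_pow_right (by positivity) (Nat.mul_le_mul_left _ (logStar_le_iff.2 le_rfl))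
    _ = 2 ^ (c * (2 * (l + 2))) := (pow_mul _ _ _).symm
    _ ≤ 2 ^ 2 ^ tower l := Nat.pow_le_pow_right two_pos
        (hexp.trans (h.le.trans (Nat.pow_le_pow_right two_pos (lt_tower l).le)))
    _ = tower (l + 2) := rfl

theorem exists_strictMono_exhausting {α : Type*} [Countable α] [Infinite α] (s : Finset α) :
    ∃ F : ℕ → Finset α, s ⊆ F 0 ∧ StrictMono F ∧ ∀ a, ∃ i, a ∈ F i := by
  obtain ⟨_⟩ := nonempty_denumerable α
  let e : α ≃ ℕ := Denumerable.eqv α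
  let F : ℕ → Finset α := fun i => (Finset.range (s.sup e + 1 + i)).map e.symm.toEmbedding
  have mem_iff : ∀ a i, a ∈ F i ↔ e a < s.sup e + 1 + i := fun a i => by
    simp [F, Finset.mem_map_equiv]
  refine ⟨F, fun a ha => (mem_iff a 0).2 (Nat.lt_succ_of_le (Finset.le_sup ha)), fun i j hij => ?_,
    fun a => ⟨e a, (mem_iff a _).2 (by omega)⟩⟩
  exact Finset.map_ssubset_map.2 (Finset.ssubset_iff_subset_ne.2
    ⟨Finset.range_subset_range.2 (by omega),
      fun h => hij.ne (by simpa using congrArg Finset.card h)⟩)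

theorem exists_isTileSequence {Γ : Type u} [Group Γ] [DecidableEq Γ] [Countable Γ] [Infinite Γ]
    (S : Finset Γ) : ∃ (F : ℕ → Finset Γ) (n : ℕ → ℕ), IsTileSequence S F n := by
  obtain ⟨F, hbase, hmono, hexh⟩ := exists_strictMono_exhausting (S ∪ S⁻¹ ∪ {1})
  choose n hn2 hn using fun i => exists_pow_logStar_le (F i).card
  have hS : ∀ i, S ∪ S⁻¹ ∪ {1} ⊆ F i := fun i => hbase.trans (hmono.monotone i.zero_le)
  exact ⟨F, n, hbase, hmono, hexh, fun i => one_le_two.trans (hn2 i), hn, fun i =>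
    (hS i).trans (Finset.subset_pow (hS i (by simp)) (logStar_ne_zero (hn2 i)))⟩

end LogStar

section ColeVishkin

/-- The least position in which the binary expansions of two distinct numbers differ. -/
noncomputable def bitDiff (a b : ℕ) : ℕ := sInf {i | a.testBit i ≠ b.testBit i}

theorem testBit_bitDiff_ne {a b : ℕ} (h : a ≠ b) :
    a.testBit (bitDiff a b) ≠ b.testBit (bitDiff a b) :=
  Nat.sInf_mem (s := {i | a.testBit i ≠ b.testBit i}) (Nat.exists_testBit_ne_of_ne h)

theorem bitDiff_lt {a b l : ℕ} (h : a ≠ b) (ha : a < 2 ^ l) (hb : b < 2 ^ l) :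
    bitDiff a b < l := by
  by_contra! hl
  have hpow : 2 ^ l ≤ 2 ^ bitDiff a b := Nat.pow_le_pow_right two_pos hl
  apply testBit_bitDiff_ne h
  rw [Nat.testBit_lt_two_pow (ha.trans_le hpow), Nat.testBit_lt_two_pow (hb.trans_le hpow)]

variable {α : Type*} {f : α → α} {c : α → ℕ}

/-- One round of the Cole–Vishkin color reduction along the orbits of `f`: the new color of `x`
encodes the least position at which the colors of `x` and `f x` differ, together with the bit of the
color of `x` at that position. -/
noncomputable def colorReduction (f : α → α) (c : α → ℕ) (x : α) : ℕ :=
  Nat.bit ((c x).testBit (bitDiff (c x) (c (f x)))) (bitDiff (c x) (c (f x)))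

theorem colorReduction_ne (hc : ∀ x, c (f x) ≠ c x) (x : α) :
    colorReduction f c (f x) ≠ colorReduction f c x := by
  intro h
  have hpos := congrArg Nat.div2 h
  have hbit := congrArg Nat.bodd h
  simp only [colorReduction, Nat.div2_bit] at hpos
  simp only [colorReduction, Nat.bodd_bit, hpos] at hbit
  exact testBit_bitDiff_ne (hc x).symm hbit.symm

theorem colorReduction_lt (hc : ∀ x, c (f x) ≠ c x) {l : ℕ} (hl : ∀ x, c x < 2 ^ l) (x : α) :
    colorReduction f c x < 2 * l :=
  Nat.bit_lt_bit _ false (bitDiff_lt (hc x).symm (hl x) (hl (f x)))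

theorem iterate_colorReduction_congr {β : Type*} {g : β → β} (t : ℕ) {d : β → ℕ} {x : α} {y : β}
    (h : ∀ a ≤ t, c (f^[a] x) = d (g^[a] y)) :
    (colorReduction f)^[t] c x = (colorReduction g)^[t] d y := by
  induction t generalizing c d with
  | zero => exact h 0 le_rfl
  | succ t ih =>
    rw [Function.iterate_succ_apply, Function.iterate_succ_apply]
    refine ih fun a ha => ?_
    have hnext := h (a + 1) (by omega)
    rw [Function.iterate_succ_apply', Function.iterate_succ_apply'] at hnext
    rw [colorReduction, colorReduction, h a (by omega), hnext]

theorem iterate_colorReduction (t : ℕ) (hc : ∀ x, c (f x) ≠ c x)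
    (hlt : ∀ x, c x < 2 * (tower t + 2)) :
    (∀ x, (colorReduction f)^[t] c (f x) ≠ (colorReduction f)^[t] c x) ∧
      ∀ x, (colorReduction f)^[t] c x < 6 := by
  induction t generalizing c with
  | zero => exact ⟨hc, hlt⟩
  | succ t ih =>
    rw [Function.iterate_succ_apply]
    refine ih (colorReduction_ne hc) (colorReduction_lt hc fun x => (hlt x).trans_le ?_)
    have htwo : 2 ≤ 2 ^ tower t := Nat.le_self_pow ((Nat.zero_le t).trans_lt (lt_tower t)).ne' 2
    rw [tower, pow_add]
    omega

end ColeVishkin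

section ColoringSpace

theorem exists_finset_forall_eq_of_continuous {ι : Type*} {A : ι → Type*}
    [∀ i, TopologicalSpace (A i)] [∀ i, DiscreteTopology (A i)] {K : Set (∀ i, A i)}
    [CompactSpace K] {β : Type*} [TopologicalSpace β] [DiscreteTopology β] {f : K → β}
    (hf : Continuous f) :
    ∃ W : Finset ι, ∀ y z : K, (∀ i ∈ W, y.1 i = z.1 i) → f y = f z := by
  classical
  have hlocal : ∀ y : K, ∃ I : Finset ι, ∀ z : K, (∀ i ∈ I, z.1 i = y.1 i) → f z = f y := by
    intro y
    obtain ⟨O, hO, hOf⟩ := isOpen_induced_iff.1 ((isOpen_discrete {f y}).preimage hf)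
    obtain ⟨I, U, hU, hIU⟩ := isOpen_pi_iff.1 hO y.1 (hOf.superset rfl)
    exact ⟨I, fun z hz => hOf.subset (hIU fun i hi => by rw [hz i hi]; exact (hU i hi).2)⟩
  choose I hI using hlocal
  have hopen : ∀ y : K, IsOpen {z : K | ∀ i ∈ I y, z.1 i = y.1 i} := fun y => by
    simp only [Set.ofPred_forall]
    exact isOpen_biInter_finset fun i _ => (isOpen_discrete {y.1 i}).preimage
      ((continuous_apply i).comp continuous_subtype_val)
  obtain ⟨s, hs⟩ := isCompact_univ.elim_finite_subcover _ hopen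
    fun y _ => Set.mem_iUnion.2 ⟨y, fun _ _ => rfl⟩
  refine ⟨s.biUnion I, fun y z h => ?_⟩
  obtain ⟨x, hx, hxy⟩ := Set.mem_iUnion₂.1 (hs (Set.mem_univ y))
  refine (hI x y hxy).trans (hI x z fun i hi => ?_).symm
  rw [← h i (Finset.mem_biUnion.2 ⟨x, hx, hi⟩), hxy i hi]

variable {Γ : Type u} [Group Γ]

/-- The space of families of `6`-colorings of `Γ`, one for each `γ ≠ 1`, that are proper with
respect to the left translation by `γ`. It is the compact free `Γ`-space to which statement (2) of
the theorem is applied: colorings of `H_{D,n}` are read off from a coloring of this space. -/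
abbrev ColoringSpace (Γ : Type u) [Group Γ] : Type u :=
  {y : {γ : Γ // γ ≠ 1} × Γ → Fin 6 | ∀ γ δ, y (γ, γ * δ) ≠ y (γ, δ)}

namespace ColoringSpace

theorem isClosed : IsClosed
    {y : {γ : Γ // γ ≠ 1} × Γ → Fin 6 | ∀ γ δ, y (γ, γ * δ) ≠ y (γ, δ)} := by
  simp only [Set.ofPred_forall]
  refine isClosed_iInter fun γ => isClosed_iInter fun δ => ?_
  have hcont : Continuous fun y : {γ : Γ // γ ≠ 1} × Γ → Fin 6 => (y (γ, γ * δ), y (γ, δ)) :=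
    (continuous_apply _).prodMk (continuous_apply _)
  exact (isClosed_discrete {p : Fin 6 × Fin 6 | p.1 ≠ p.2}).preimage hcont

instance : CompactSpace (ColoringSpace Γ) := isCompact_iff_compactSpace.1 isClosed.isCompact

instance [Countable Γ] : PolishSpace (ColoringSpace Γ) :=
  have : PolishSpace (Fin 6) := inferInstance
  isClosed.polishSpace

theorem zeroDimensional : ZeroDimensional (ColoringSpace Γ) := isTopologicalBasis_isClopen

instance : MulAction Γ (ColoringSpace Γ) where
  smul η y := ⟨fun w => y.1 (w.1, w.2 * η), fun γ δ => by
    simpa only [mul_assoc] using y.2 γ (δ * η)⟩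
  one_smul y := Subtype.ext (funext fun w => congrArg (fun δ => y.1 (w.1, δ)) (mul_one w.2))
  mul_smul η η' y := Subtype.ext (funext fun w =>
    congrArg (fun δ => y.1 (w.1, δ)) (mul_assoc w.2 η η').symm)

theorem smul_apply (η : Γ) (y : ColoringSpace Γ) (w : {γ : Γ // γ ≠ 1} × Γ) :
    (η • y).1 w = y.1 (w.1, w.2 * η) := rfl

instance : ContinuousConstSMul Γ (ColoringSpace Γ) :=
  ⟨fun η => Continuous.subtype_mk (continuous_pi fun w =>
    (continuous_apply (w.1, w.2 * η)).comp continuous_subtype_val) _⟩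

theorem freeAction : FreeAction Γ (ColoringSpace Γ) := fun y =>
  (Subgroup.eq_bot_iff_forall _).2 fun η hη => by
    by_contra hη1
    apply y.2 ⟨η, hη1⟩ 1
    calc y.1 (⟨η, hη1⟩, η * 1) = (η • y).1 (⟨η, hη1⟩, 1) := by rw [smul_apply, one_mul, mul_one]
      _ = y.1 (⟨η, hη1⟩, 1) := by rw [MulAction.mem_stabilizer_iff.1 hη]

end ColoringSpace

theorem exists_three_coloring [Countable Γ] {γ : Γ} (hγ : γ ≠ 1) :
    ∃ c : Γ → Fin 3, ∀ x, c (γ * x) ≠ c x := by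
  classical
  let _ : TopologicalSpace Γ := ⊥
  have : DiscreteTopology Γ := ⟨rfl⟩
  have : ContinuousConstSMul Γ Γ := ⟨fun _ => continuous_of_discreteTopology⟩
  have hfree : FreeAction Γ Γ := fun x => (Subgroup.eq_bot_iff_forall _).2 fun η hη =>
    mul_eq_right.1 (MulAction.mem_stabilizer_iff.1 hη)
  obtain ⟨c, -, hc⟩ := exists_proper_coloring loc_compact_Haus_tot_disc_of_zero_dim
    hfree {γ, γ⁻¹} (by simp) (V := Fin 3)
    ((Finset.card_erase_le.trans Finset.card_le_two).trans_lt (by simp))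
  exact ⟨c, fun x => hc x γ (by simp) hγ⟩

end ColoringSpace

section ExtendTile

variable {α : Type*} [DecidableEq α] {D : Finset α} {n : ℕ}

/-- The numbering given by `q` on `D` and extended by the junk value `0` outside `D`. -/
def extendTile (q : D ↪ Fin n) (u : α) : ℕ := if h : u ∈ D then q ⟨u, h⟩ else 0

theorem extendTile_of_mem (q : D ↪ Fin n) {u : α} (hu : u ∈ D) : extendTile q u = q ⟨u, hu⟩ :=
  dif_pos hu

theorem injOn_extendTile (q : D ↪ Fin n) : Set.InjOn (extendTile q) D := by
  intro u hu u' hu' h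
  rw [extendTile_of_mem q hu, extendTile_of_mem q hu'] at h
  exact congrArg Subtype.val (q.injective (Fin.ext h))

end ExtendTile

section TilesOfSpaces

variable {Γ : Type u} [Group Γ]

theorem ColoringSpace.exists_eq_iterate_colorReduction [Countable Γ] {T : ℕ} {U : Set Γ}
    {b : Γ → ℕ} (hinj : U.InjOn b) (hlt : ∀ u ∈ U, b u < tower T) :
    ∃ y : ColoringSpace Γ, ∀ w, (∀ a ≤ T, (w.1 : Γ) ^ a * w.2 ∈ U) →
      (y.1 w : ℕ) = (colorReduction ((w.1 : Γ) * ·))^[T] b w.2 := by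
  classical
  choose c₃ hc₃ using fun γ : {γ : Γ // γ ≠ 1} => exists_three_coloring γ.2
  let c : {γ : Γ // γ ≠ 1} → Γ → ℕ := fun γ u => if u ∈ U then b u else tower T + c₃ γ u
  have hc : ∀ γ u, c γ (γ * u) ≠ c γ u := by
    intro γ u
    simp only [c]
    split_ifs with hγu hu hu
    · exact fun heq => γ.2 (mul_eq_right.1 (hinj hγu hu heq))
    · exact ((hlt _ hγu).trans_le (Nat.le_add_right _ _)).ne
    · exact ((hlt _ hu).trans_le (Nat.le_add_right _ _)).ne'
    · exact fun heq => hc₃ γ u (Fin.ext (Nat.add_left_cancel heq))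
  have hclt : ∀ γ u, c γ u < 2 * (tower T + 2) := by
    intro γ u
    simp only [c]
    split_ifs with hu
    · exact (hlt u hu).trans (by omega)
    · omega
  refine ⟨⟨fun w => ⟨(colorReduction ((w.1 : Γ) * ·))^[T] (c w.1) w.2,
      (iterate_colorReduction T (hc w.1) (hclt w.1)).2 w.2⟩, fun γ δ heq =>
      (iterate_colorReduction T (hc γ) (hclt γ)).1 δ (congrArg Fin.val heq)⟩,
    fun w hw => iterate_colorReduction_congr T fun a ha => if_pos ?_⟩
  rw [mul_left_iterate]
  exact hw a ha

instance [Countable Γ] : Nonempty (ColoringSpace Γ) :=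
  (ColoringSpace.exists_eq_iterate_colorReduction (T := 0) (b := 0) (Set.injOn_empty _)
    (by simp)).nonempty

variable [DecidableEq Γ] {k : ℕ} {S D : Finset Γ} {P : Set (Pattern Γ k)}

theorem Pattern.SConnected.eq_of_forall_adj {p : Pattern Γ k} (hp : p.SConnected S) {α : Type*}
    {ψ : p.dom → α}
    (h : ∀ a b, ((cayleyGraph S).induce (p.dom : Set Γ)).graph.Adj a b → ψ a = ψ b)
    (a b : p.dom) : ψ a = ψ b := by
  obtain ⟨w⟩ := hp.preconnected a b
  induction w with
  | nil => rfl
  | cons hadj _ ih => exact (h _ _ hadj).trans ih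

theorem LabeledGraph.hasAvoidingColoring_of_subset_one {V : Type*} (G : LabeledGraph S V)
    (hS : S ⊆ {1}) (hPS : ∀ p ∈ P, p.SConnected S) {X : Type*} [MulAction Γ X] [Nonempty X]
    {f : X → Fin k} (hf : ∀ p ∈ P, ¬ p.Occurs f) : G.HasAvoidingColoring P := by
  obtain ⟨x⟩ := ‹Nonempty X›
  refine ⟨fun _ => f x, fun p hp ⟨_, _, hφp⟩ => ?_⟩
  obtain ⟨η₀⟩ := (hPS p hp).nonempty
  refine hf p hp ⟨(η₀ : Γ)⁻¹ • x, fun η => ?_⟩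
  have hη : (η : Γ) = η₀ := by
    refine (hPS p hp).eq_of_forall_adj (ψ := fun η : p.dom => (η : Γ)) ?_ η η₀
    rintro a b ⟨-, σ, hσ, hab : (b : Γ) = σ * a⟩
    obtain rfl : σ = 1 := by
      rcases Finset.mem_union.1 hσ with hσ | hσ
      · exact Finset.mem_singleton.1 (hS hσ)
      · exact inv_eq_one.1 (Finset.mem_singleton.1 (hS (Finset.mem_inv'.1 hσ)))
    rw [hab, one_mul]
  rw [hη, smul_inv_smul]
  exact hφp η

variable {n : ℕ}

theorem extendTile_eq_of_isHom {p : Pattern Γ k} (hp : p.SConnected S) (hD : S ∪ S⁻¹ ∪ {1} ⊆ D)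
    {φ : p.dom → (D ↪ Fin n)}
    (hφ : ((cayleyGraph S).induce (p.dom : Set Γ)).IsHom (tileGraph S D n hD) φ) {u : Γ}
    (hu : ∀ η ∈ p.dom, u * η⁻¹ ∈ D) (η η' : p.dom) :
    extendTile (φ η) (u * (η : Γ)⁻¹) = extendTile (φ η') (u * (η' : Γ)⁻¹) := by
  refine hp.eq_of_forall_adj (ψ := fun η : p.dom => extendTile (φ η) (u * (η : Γ)⁻¹)) ?_ η η'
  intro a b hab
  obtain ⟨⟨-, σ, hσ, hcomp⟩, hlabel⟩ := hφ a b hab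
  have hσab : σ = (b : Γ) * (a : Γ)⁻¹ := (tileLabel_eq hD hσ hcomp).symm.trans hlabel
  simp only [extendTile_of_mem _ (hu a a.2), extendTile_of_mem _ (hu b b.2)]
  rw [hcomp ⟨_, hu a a.2⟩ ⟨_, hu b b.2⟩ (by simp [hσab])]

/-- The color that `T` rounds of color reduction produce from the tile `q` at a coordinate of
`ColoringSpace Γ`. -/
noncomputable def tileColor (T : ℕ) (q : D ↪ Fin n) (w : {γ : Γ // γ ≠ 1} × Γ) : ℕ :=
  (colorReduction ((w.1 : Γ) * ·))^[T] (extendTile q) w.2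

theorem exists_smul_eq_tileColor [Countable Γ] {T : ℕ} (hn : n ≤ tower T) {p : Pattern Γ k}
    (hp : p.SConnected S) (hD : S ∪ S⁻¹ ∪ {1} ⊆ D) {φ : p.dom → (D ↪ Fin n)}
    (hφ : ((cayleyGraph S).induce (p.dom : Set Γ)).IsHom (tileGraph S D n hD) φ)
    {W : Finset ({γ : Γ // γ ≠ 1} × Γ)}
    (hW : ∀ w ∈ W, ∀ η ∈ p.dom, ∀ η' ∈ p.dom, ∀ a ≤ T,
      (w.1 : Γ) ^ a * (w.2 * η * η'⁻¹) ∈ D) :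
    ∃ y : ColoringSpace Γ, ∀ η : p.dom, ∀ w ∈ W,
      (((η : Γ) • y).1 w : ℕ) = tileColor T (φ η) w := by
  obtain ⟨η₀⟩ := hp.nonempty
  let U : Set Γ := {u | ∀ η ∈ p.dom, u * η⁻¹ ∈ D}
  have hinj : U.InjOn fun u => extendTile (φ η₀) (u * (η₀ : Γ)⁻¹) := fun u hu u' hu' h =>
    mul_right_cancel (injOn_extendTile _ (hu η₀ η₀.2) (hu' η₀ η₀.2) h)
  have hlt : ∀ u ∈ U, extendTile (φ η₀) (u * (η₀ : Γ)⁻¹) < tower T := fun u hu => by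
    rw [extendTile_of_mem _ (hu η₀ η₀.2)]
    exact (Fin.is_lt _).trans_le hn
  obtain ⟨y, hy⟩ := ColoringSpace.exists_eq_iterate_colorReduction hinj hlt
  refine ⟨y, fun η w hw => ?_⟩
  have hU : ∀ a ≤ T, (w.1 : Γ) ^ a * (w.2 * η) ∈ U := fun a ha η' hη' => by
    rw [mul_assoc]
    exact hW w hw η η.2 η' hη' a ha
  rw [ColoringSpace.smul_apply, hy (w.1, w.2 * η) hU]
  refine iterate_colorReduction_congr T fun a ha => ?_
  rw [mul_left_iterate, extendTile_eq_of_isHom hp hD hφ (hU a ha) η₀ η]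
  simp only [mul_assoc, mul_inv_cancel, mul_one]

theorem tileGraph_hasAvoidingColoring_of_coloringSpace [Countable Γ]
    (hPS : ∀ p ∈ P, p.SConnected S) {f : ColoringSpace Γ → Fin k} (hf : ∀ p ∈ P, ¬ p.Occurs f)
    {W : Finset ({γ : Γ // γ ≠ 1} × Γ)}
    (hW : ∀ y z : ColoringSpace Γ, (∀ w ∈ W, y.1 w = z.1 w) → f y = f z)
    {T : ℕ} (hn : n ≤ tower T) (hD : S ∪ S⁻¹ ∪ {1} ⊆ D)
    (hDW : ∀ p ∈ P, ∀ w ∈ W, ∀ η ∈ p.dom, ∀ η' ∈ p.dom, ∀ a ≤ T,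
      (w.1 : Γ) ^ a * (w.2 * η * η'⁻¹) ∈ D) :
    (tileGraph S D n hD).HasAvoidingColoring P := by
  let Matches (q : D ↪ Fin n) (y : ColoringSpace Γ) : Prop := ∀ w ∈ W, (y.1 w : ℕ) = tileColor T q w
  refine ⟨fun q => f (Classical.epsilon (Matches q)), fun p hp ⟨φ, hφ, hφp⟩ => ?_⟩
  obtain ⟨y, hy⟩ := exists_smul_eq_tileColor hn (hPS p hp) hD hφ (hDW p hp)
  refine hf p hp ⟨y, fun η => (hW _ _ fun w hw => Fin.ext ?_).trans (hφp η)⟩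
  have hmatch : Matches (φ η) (Classical.epsilon (Matches (φ η))) :=
    Classical.epsilon_spec ⟨(η : Γ) • y, hy η⟩
  exact (hy η w hw).trans (hmatch w hw).symm

theorem pow_mul_mem_pow {F : Finset Γ} {γ x : Γ} (h1 : 1 ∈ F) (hγ : γ ∈ F) (hx : x ∈ F)
    (hγx : γ * x ∈ F) {a T : ℕ} (hT : T ≠ 0) (ha : a ≤ T) : γ ^ a * x ∈ F ^ T := by
  cases a with
  | zero =>
    rw [pow_zero, one_mul]
    exact Finset.subset_pow h1 hT hx
  | succ a =>
    rw [pow_succ, mul_assoc]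
    refine Finset.pow_subset_pow_right h1 ha ?_
    rw [pow_succ]
    exact Finset.mul_mem_mul (Finset.pow_mem_pow hγ) hγx

theorem IsTileSequence.eventually_mem {F : ℕ → Finset Γ} {n : ℕ → ℕ} (hFn : IsTileSequence S F n)
    (γ : Γ) : ∀ᶠ i in atTop, γ ∈ F i := by
  obtain ⟨i, hi⟩ := hFn.exhausts γ
  filter_upwards [eventually_ge_atTop i] with j hj using hFn.strictMono.monotone hj hi

theorem IsTileSequence.finite_not_hasAvoidingColoring [Countable Γ] (hP : P.Finite)
    (hPS : ∀ p ∈ P, p.SConnected S) (h : HasContinuousAvoidingColoring P (ColoringSpace Γ))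
    {F : ℕ → Finset Γ} {n : ℕ → ℕ} (hFn : IsTileSequence S F n) :
    {i | ¬ (tileGraph S (F i ^ logStar (n i)) (n i)
      (hFn.subset i)).HasAvoidingColoring P}.Finite := by
  obtain ⟨f, hf, hfP⟩ := h
  obtain ⟨W, hW⟩ := exists_finset_forall_eq_of_continuous hf
  have hev : ∀ᶠ i in atTop, ∀ p ∈ P, ∀ w ∈ W, ∀ η ∈ p.dom, ∀ η' ∈ p.dom,
      (w.1 : Γ) ∈ F i ∧ w.2 * η * η'⁻¹ ∈ F i ∧ (w.1 : Γ) * (w.2 * η * η'⁻¹) ∈ F i :=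
    (eventually_all_finite hP).2 fun p _ => (eventually_all_finset W).2 fun w _ =>
      (eventually_all_finset _).2 fun η _ => (eventually_all_finset _).2 fun η' _ =>
        (hFn.eventually_mem _).and ((hFn.eventually_mem _).and (hFn.eventually_mem _))
  rw [← Nat.cofinite_eq_atTop] at hev
  refine (eventually_cofinite.1 hev).subset fun i hi hmem => hi ?_
  by_cases hT : logStar (n i) = 0
  · refine LabeledGraph.hasAvoidingColoring_of_subset_one _ (fun σ hσ => ?_) hPS hfP
    simpa [hT] using hFn.subset i (Finset.mem_union_left _ (Finset.mem_union_left _ hσ))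
  · have h1 : (1 : Γ) ∈ F i := hFn.strictMono.monotone (Nat.zero_le i) (hFn.base (by simp))
    refine tileGraph_hasAvoidingColoring_of_coloringSpace hPS hfP hW (le_tower_logStar (n i)) _ ?_
    intro p hp w hw η hη η' hη' a ha
    obtain ⟨hγ, hx, hγx⟩ := hmem p hp w hw η hη η' hη'
    exact pow_mul_mem_pow h1 hγ hx hγx hT ha

end TilesOfSpaces

end ContinuousColoring

theorem theorem1p9 {Γ : Type u} [Group Γ] [DecidableEq Γ] [Countable Γ] [Infinite Γ]
    (S : Finset Γ) :
    (∃ (F : ℕ → Finset Γ) (n : ℕ → ℕ), ContinuousColoring.IsTileSequence S F n) ∧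
    ∀ (F : ℕ → Finset Γ) (n : ℕ → ℕ) (hFn : ContinuousColoring.IsTileSequence S F n)
      (k : ℕ) (_ : 1 ≤ k) (P : Set (ContinuousColoring.Pattern Γ k)) (_ : P.Finite)
      (_ : ∀ p ∈ P, p.SConnected S),
      List.TFAE [
        ContinuousColoring.HasContinuousAvoidingColoring P
          (ContinuousColoring.FreePart Γ (ContinuousColoring.Shift Γ 2)),
        ∀ (X : Type u) [TopologicalSpace X] [PolishSpace X] [MulAction Γ X]
          [ContinuousConstSMul Γ X],
          ContinuousColoring.ZeroDimensional X → ContinuousColoring.FreeAction Γ X →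
            ContinuousColoring.HasContinuousAvoidingColoring P X,
        ∃ i, (ContinuousColoring.tileGraph S (F i ^ ContinuousColoring.logStar (n i)) (n i)
          (hFn.subset i)).HasAvoidingColoring P,
        {i | ¬ (ContinuousColoring.tileGraph S (F i ^ ContinuousColoring.logStar (n i)) (n i)
          (hFn.subset i)).HasAvoidingColoring P}.Finite] := by
  refine ⟨ContinuousColoring.exists_isTileSequence S, fun F n hFn k hk P hP hPS => ?_⟩
  have : NeZero k := ⟨Nat.one_le_iff_ne_zero.1 hk⟩
  tfae_have 1 → 2 := fun h X _ _ _ _ hX hfree =>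
    ContinuousColoring.hasContinuousAvoidingColoring_of_freePart hP h X hX hfree
  tfae_have 2 → 4 := fun h =>
    hFn.finite_not_hasAvoidingColoring hP hPS
      (h (ContinuousColoring.ColoringSpace Γ) ContinuousColoring.ColoringSpace.zeroDimensional
        ContinuousColoring.ColoringSpace.freeAction)
  tfae_have 4 → 3 := fun h => by
    obtain ⟨i, hi⟩ := h.exists_notMem
    exact ⟨i, not_not.1 hi⟩
  tfae_have 3 → 1 := fun ⟨i, hi⟩ => by
    have hcard : (F i ^ ContinuousColoring.logStar (n i)).card ^ 2 ≤ n i := by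
      refine (Nat.pow_le_pow_left Finset.card_pow_le 2).trans ?_
      rw [← pow_mul, mul_comm]
      exact hFn.card_pow_le i
    exact ContinuousColoring.hasContinuousAvoidingColoring_of_tileGraph (hFn.subset i) hcard hi _
      (ContinuousColoring.zeroDimensional_freePart_shift 2)
      (ContinuousColoring.freeAction_freePart _)
  tfae_finish
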